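/- Let $\overline{\mathbb Q}$ be the field of algebraic numbers. For a prime $p$ let $\overline{\mathbb Q}_p$ be an algebraic closure of $\mathbb Q_p$, $\overline{\mathbb Z}_p$ its ring of integers, $\mathfrak m$ the maximal ideal of $\overline{\mathbb Z}_p$, and $\overline{\mathbb F}_p=\overline{\mathbb Z}_p/\mathfrak m$. For each prime $p$ fix an arbitrary embedding $\iota_p:\overline{\mathbb Q}\to\overline{\mathbb Q}_p$. A semisimple rigid tensor category over an algebraically closed field $k$ is a $k$-linear abelian rigid monoidal category with $k$-bilinear tensor product and finite dimensional $\mathrm{Hom}$ spaces, whose unit object is simple and in which every object is a finite direct sum of simple objects; it is a fusion category if it has only finitely many simple objects up to isomorphism. A semisimple rigid tensor category over $\overline{\mathbb Z}_p$ is a $\overline{\mathbb Z}_p$-linear additive rigid monoidal category with bilinear tensor product and $\mathrm{End}(\mathbf 1)=\overline{\mathbb Z}_p$ that is equivalent, as a $\overline{\mathbb Z}_p$-linear category, to a direct sum of copies of the category of free $\overline{\mathbb Z}_p$-modules of finite rank. For a homomorphism of commutative rings $R\to S$ and an $R$-linear monoidal category $\mathcal D$, the category $\mathcal D\otimes_R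 S$ has the objects of $\mathcal D$ and morphisms $S\otimes_R\mathrm{Hom}_{\mathcal D}(X,Y)$. Let $\mathcal C$ be a semisimple rigid tensor category over $\overline{\mathbb Q}$. A good reduction of $\mathcal C$ modulo $p$ is a semisimple rigid tensor category $\mathcal C_p$ over $\overline{\mathbb F}_p$ with the same Grothendieck ring as $\mathcal C$ (by a ring isomorphism matching the classes of simple objects), for which there is a semisimple rigid tensor category $\widetilde{\mathcal C}_p$ over $\overline{\mathbb Z}_p$ with linear tensor equivalences $\widetilde{\mathcal C}_p\otimes_{\overline{\mathbb Z}_p}\overline{\mathbb F}_p\cong\mathcal C_p$ and $\widetilde{\mathcal C}_p\otimes_{\overline{\mathbb Z}_p}\overline{\mathbb Q}_p\cong\mathcal C\otimes_{\overline{\mathbb Q}}\overline{\mathbb Q}_p$, the last scalar extension being along $\iota_p$. The prime $p$ is good for $\mathcal C$ if a good reduction of $\mathcal C$ modulo $p$ exists, and bad for $\mathcal C$ otherwise. **Proposition.** For every fusion category $\mathcal C$ over $\overline{\mathbb Q}$, the set of primes that are bad for $\mathcal C$ is finite. -/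

import Mathlib

open CategoryTheory MonoidalCategory Limits
open scoped TensorProduct Valued

universe w v u v₁ u₁ v₂ u₂

/-! ### Extension of scalars of a linear (monoidal) category -/

/-- The extension of scalars `S ⊗_R C` of an `R`-linear category `C` along `R → S`: it has the
same objects as `C`, and `Hom(X, Y) = S ⊗_R Hom_C(X, Y)`. -/
structure ScalarExtension (R : Type*) (S : Type*) (C : Type u) where
  /-- the underlying object of `C` -/
  obj : C

namespace ScalarExtension

variable {R : Type*} [CommRing R] {S : Type w} [CommRing S] [Algebra R S]
variable {C : Type u} [Category.{v} C] [Preadditive C] [Linear R C]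

/-- Composition: `(s ⊗ f) ≫ (t ⊗ g) = (s * t) ⊗ (f ≫ g)`. -/
noncomputable def compMap (R : Type*) [CommRing R] (S : Type w) [CommRing S] [Algebra R S]
    {C : Type u} [Category.{v} C] [Preadditive C] [Linear R C] (X Y Z : C) :
    S ⊗[R] (X ⟶ Y) →ₗ[R] S ⊗[R] (Y ⟶ Z) →ₗ[R] S ⊗[R] (X ⟶ Z) :=
  TensorProduct.map₂ (LinearMap.mul R S) (Linear.comp X Y Z)

@[simp]
theorem compMap_tmul (X Y Z : C) (s t : S) (f : X ⟶ Y) (g : Y ⟶ Z) :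
    compMap R S X Y Z (s ⊗ₜ f) (t ⊗ₜ g) = (s * t) ⊗ₜ (f ≫ g) := by
  simp [compMap]

noncomputable instance : Category.{max w v} (ScalarExtension R S C) where
  Hom X Y := S ⊗[R] (X.obj ⟶ Y.obj)
  id X := 1 ⊗ₜ 𝟙 X.obj
  comp {X Y Z} f g := compMap R S X.obj Y.obj Z.obj f g
  id_comp {X Y} f := by
    induction f using TensorProduct.induction_on with
    | zero => simp
    | tmul s f => simp
    | add f g hf hg => rw [map_add, hf, hg]
  comp_id {X Y} f := by
    induction f using TensorProduct.induction_on with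
    | zero => simp
    | tmul s f => simp
    | add f g hf hg => rw [map_add, LinearMap.add_apply, hf, hg]
  assoc {W X Y Z} f g h := by
    induction f using TensorProduct.induction_on with
    | zero => simp
    | add f f' hf hf' => simp only [map_add, LinearMap.add_apply, hf, hf']
    | tmul s f =>
      induction g using TensorProduct.induction_on with
      | zero => simp
      | add g g' hg hg' => simp only [map_add, LinearMap.add_apply, hg, hg']
      | tmul t g =>
        induction h using TensorProduct.induction_on with
        | zero => simp
        | add h h' hh hh' => simp only [map_add, hh, hh']
        | tmul r h => simp [mul_assoc]

/-- The morphism `s ⊗ f` of the scalar extension. -/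
noncomputable def homMk {X Y : ScalarExtension R S C} (s : S) (f : X.obj ⟶ Y.obj) : X ⟶ Y :=
  (s ⊗ₜ[R] f : S ⊗[R] (X.obj ⟶ Y.obj))

noncomputable instance (X Y : ScalarExtension R S C) : AddCommGroup (X ⟶ Y) :=
  inferInstanceAs (AddCommGroup (S ⊗[R] (X.obj ⟶ Y.obj)))

noncomputable instance (X Y : ScalarExtension R S C) : Module S (X ⟶ Y) :=
  inferInstanceAs (Module S (S ⊗[R] (X.obj ⟶ Y.obj)))

noncomputable instance : Preadditive (ScalarExtension R S C) where
  add_comp X Y Z f f' g := by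
    change compMap R S X.obj Y.obj Z.obj (f + f') g = _
    rw [map_add]; rfl
  comp_add X Y Z f g g' := (compMap R S X.obj Y.obj Z.obj f).map_add g g'

theorem hom_induction {X Y : ScalarExtension R S C} {P : (X ⟶ Y) → Prop} (f : X ⟶ Y)
    (zero : P 0) (mk : ∀ (s : S) (f : X.obj ⟶ Y.obj), P (homMk s f))
    (add : ∀ f g : X ⟶ Y, P f → P g → P (f + g)) : P f :=
  TensorProduct.induction_on (motive := P) f zero mk add

theorem homMk_comp {X Y Z : ScalarExtension R S C} (s t : S) (f : X.obj ⟶ Y.obj)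
    (g : Y.obj ⟶ Z.obj) : (homMk s f : X ⟶ Y) ≫ homMk t g = homMk (s * t) (f ≫ g) :=
  compMap_tmul X.obj Y.obj Z.obj s t f g

theorem id_eq (X : ScalarExtension R S C) : 𝟙 X = homMk 1 (𝟙 X.obj) := rfl

noncomputable instance : Linear S (ScalarExtension R S C) where
  smul_comp X Y Z r f g := by
    induction f using hom_induction with
    | zero => rw [smul_zero, zero_comp, smul_zero]
    | add f f' hf hf' => rw [smul_add, Preadditive.add_comp, hf, hf', Preadditive.add_comp,
        smul_add]
    | mk s f =>
      induction g using hom_induction with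
      | zero => rw [comp_zero, comp_zero, smul_zero]
      | add g g' hg hg' => rw [Preadditive.comp_add, hg, hg', Preadditive.comp_add, smul_add]
      | mk t g =>
        change homMk (r * s) f ≫ homMk t g = r • (homMk s f ≫ homMk t g)
        rw [homMk_comp, homMk_comp, mul_assoc]; rfl
  comp_smul X Y Z f r g := by
    induction f using hom_induction with
    | zero => rw [zero_comp, zero_comp, smul_zero]
    | add f f' hf hf' => rw [Preadditive.add_comp, hf, hf', Preadditive.add_comp, smul_add]
    | mk s f =>
      induction g using hom_induction with
      | zero => rw [smul_zero, comp_zero, smul_zero]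
      | add g g' hg hg' => rw [smul_add, Preadditive.comp_add, hg, hg', Preadditive.comp_add,
          smul_add]
      | mk t g =>
        change homMk s f ≫ homMk (r * t) g = r • (homMk s f ≫ homMk t g)
        rw [homMk_comp, homMk_comp, mul_left_comm]; rfl

/-- An isomorphism of `C` gives an isomorphism of the scalar extension. -/
@[simps]
noncomputable def isoMk {X Y : ScalarExtension R S C} (e : X.obj ≅ Y.obj) : X ≅ Y where
  hom := homMk 1 e.hom
  inv := homMk 1 e.inv
  hom_inv_id := by rw [homMk_comp, e.hom_inv_id, one_mul]; rfl
  inv_hom_id := by rw [homMk_comp, e.inv_hom_id, one_mul]; rfl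

variable [MonoidalCategory C] [MonoidalPreadditive C] [MonoidalLinear R C]

/-- `f ↦ X ◁ f` as an `R`-linear map. -/
def whiskerLeftMap (R : Type*) [CommRing R] {C : Type u} [Category.{v} C] [Preadditive C]
    [Linear R C] [MonoidalCategory C] [MonoidalPreadditive C] [MonoidalLinear R C] (X Y Z : C) :
    (Y ⟶ Z) →ₗ[R] (X ⊗ Y ⟶ X ⊗ Z) where
  toFun f := X ◁ f
  map_add' _ _ := MonoidalPreadditive.whiskerLeft_add _ _
  map_smul' r f := MonoidalLinear.whiskerLeft_smul X r f

/-- `f ↦ f ▷ X` as an `R`-linear map. -/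
def whiskerRightMap (R : Type*) [CommRing R] {C : Type u} [Category.{v} C] [Preadditive C]
    [Linear R C] [MonoidalCategory C] [MonoidalPreadditive C] [MonoidalLinear R C] (X Y Z : C) :
    (Y ⟶ Z) →ₗ[R] (Y ⊗ X ⟶ Z ⊗ X) where
  toFun f := f ▷ X
  map_add' _ _ := MonoidalPreadditive.add_whiskerRight _ _
  map_smul' r f := MonoidalLinear.smul_whiskerRight r f X

/-- The tensor product of the scalar extension is that of `C` on objects, and on morphisms it is
the `S`-linear extension of that of `C`; the unit object and the coherence isomorphisms are the
images of those of `C`. -/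
noncomputable instance : MonoidalCategoryStruct (ScalarExtension R S C) where
  tensorObj X Y := ⟨X.obj ⊗ Y.obj⟩
  whiskerLeft X Y Z f :=
    (whiskerLeftMap R X.obj Y.obj Z.obj).lTensor S f
  whiskerRight {Y Z} f X :=
    (whiskerRightMap R X.obj Y.obj Z.obj).lTensor S f
  tensorUnit := ⟨𝟙_ C⟩
  associator X Y Z := isoMk (α_ X.obj Y.obj Z.obj)
  leftUnitor X := isoMk (λ_ X.obj)
  rightUnitor X := isoMk (ρ_ X.obj)

theorem whiskerLeft_homMk (X : ScalarExtension R S C) {Y Z : ScalarExtension R S C} (s : S)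
    (f : Y.obj ⟶ Z.obj) :
    X ◁ (homMk s f : Y ⟶ Z) = homMk (X := X ⊗ Y) (Y := X ⊗ Z) s (X.obj ◁ f) := rfl

theorem homMk_whiskerRight (X : ScalarExtension R S C) {Y Z : ScalarExtension R S C} (s : S)
    (f : Y.obj ⟶ Z.obj) :
    (homMk s f : Y ⟶ Z) ▷ X = homMk (X := Y ⊗ X) (Y := Z ⊗ X) s (f ▷ X.obj) := rfl

theorem associator_def (X Y Z : ScalarExtension R S C) : (α_ X Y Z).hom =
    homMk (X := (X ⊗ Y) ⊗ Z) (Y := X ⊗ Y ⊗ Z) 1 (α_ X.obj Y.obj Z.obj).hom := rfl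

theorem leftUnitor_def (X : ScalarExtension R S C) : (λ_ X).hom =
    homMk (X := 𝟙_ _ ⊗ X) (Y := X) 1 (λ_ X.obj).hom := rfl

theorem rightUnitor_def (X : ScalarExtension R S C) : (ρ_ X).hom =
    homMk (X := X ⊗ 𝟙_ _) (Y := X) 1 (ρ_ X.obj).hom := rfl

theorem whiskerLeft_add' (X : ScalarExtension R S C) {Y Z : ScalarExtension R S C} (f g : Y ⟶ Z) :
    X ◁ (f + g) = X ◁ f + X ◁ g :=
  map_add ((whiskerLeftMap R X.obj Y.obj Z.obj).lTensor S) f g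

theorem add_whiskerRight' (X : ScalarExtension R S C) {Y Z : ScalarExtension R S C}
    (f g : Y ⟶ Z) : (f + g) ▷ X = f ▷ X + g ▷ X :=
  map_add ((whiskerRightMap R X.obj Y.obj Z.obj).lTensor S) f g

theorem whiskerLeft_zero' (X Y Z : ScalarExtension R S C) : X ◁ (0 : Y ⟶ Z) = 0 :=
  map_zero ((whiskerLeftMap R X.obj Y.obj Z.obj).lTensor S)

theorem zero_whiskerRight' (X Y Z : ScalarExtension R S C) : (0 : Y ⟶ Z) ▷ X = 0 :=
  map_zero ((whiskerRightMap R X.obj Y.obj Z.obj).lTensor S)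

theorem tensorHom_homMk {X Y X' Y' : ScalarExtension R S C} (s t : S) (f : X.obj ⟶ Y.obj)
    (g : X'.obj ⟶ Y'.obj) :
    (homMk s f : X ⟶ Y) ⊗ₘ (homMk t g : X' ⟶ Y') =
      homMk (X := X ⊗ X') (Y := Y ⊗ Y') (s * t) (f ⊗ₘ g) := by
  change homMk s f ▷ X' ≫ Y ◁ homMk t g = _
  rw [homMk_whiskerRight, whiskerLeft_homMk, homMk_comp, MonoidalCategory.tensorHom_def]

section

variable {X Y X' Y' : ScalarExtension R S C}

theorem tensorHom_eq (f : X ⟶ Y) (g : X' ⟶ Y') : f ⊗ₘ g = f ▷ X' ≫ Y ◁ g := rfl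

theorem add_tensorHom (f f' : X ⟶ Y) (g : X' ⟶ Y') : (f + f') ⊗ₘ g = f ⊗ₘ g + f' ⊗ₘ g := by
  simp only [tensorHom_eq, add_whiskerRight', Preadditive.add_comp]

theorem tensorHom_add (f : X ⟶ Y) (g g' : X' ⟶ Y') : f ⊗ₘ (g + g') = f ⊗ₘ g + f ⊗ₘ g' := by
  simp only [tensorHom_eq, whiskerLeft_add', Preadditive.comp_add]

theorem zero_tensorHom (g : X' ⟶ Y') : (0 : X ⟶ Y) ⊗ₘ g = 0 := by
  simp only [tensorHom_eq, zero_whiskerRight', zero_comp]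

theorem tensorHom_zero (f : X ⟶ Y) : f ⊗ₘ (0 : X' ⟶ Y') = 0 := by
  simp only [tensorHom_eq, whiskerLeft_zero', comp_zero]

end

noncomputable instance : MonoidalCategory (ScalarExtension R S C) where
  tensorHom_def f g := rfl
  id_tensorHom_id X Y := by
    rw [id_eq, id_eq, tensorHom_homMk, one_mul]
    exact congrArg (homMk _) (MonoidalCategory.id_tensorHom_id X.obj Y.obj)
  tensorHom_comp_tensorHom {X₁ Y₁ Z₁ X₂ Y₂ Z₂} f₁ f₂ g₁ g₂ := by
    induction f₁ using hom_induction with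
    | zero => simp only [zero_tensorHom, zero_comp]
    | add f f' h h' => simp only [add_tensorHom, Preadditive.add_comp, h, h']
    | mk a f₁ =>
    induction f₂ using hom_induction with
    | zero => simp only [tensorHom_zero, zero_comp]
    | add f f' h h' => simp only [tensorHom_add, Preadditive.add_comp, h, h']
    | mk b f₂ =>
    induction g₁ using hom_induction with
    | zero => simp only [zero_tensorHom, comp_zero]
    | add f f' h h' => simp only [add_tensorHom, Preadditive.comp_add, h, h']
    | mk c g₁ =>
    induction g₂ using hom_induction with
    | zero => simp only [tensorHom_zero, comp_zero]
    | add f f' h h' => simp only [tensorHom_add, Preadditive.comp_add, h, h']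
    | mk d g₂ =>
    rw [tensorHom_homMk, tensorHom_homMk, homMk_comp, homMk_comp, homMk_comp, tensorHom_homMk,
      mul_mul_mul_comm]
    exact congrArg (homMk _) (MonoidalCategory.tensorHom_comp_tensorHom f₁ f₂ g₁ g₂)
  whiskerLeft_id X Y := by
    rw [id_eq, whiskerLeft_homMk]
    exact congrArg (homMk _) (MonoidalCategory.whiskerLeft_id X.obj Y.obj)
  id_whiskerRight X Y := by
    rw [id_eq, homMk_whiskerRight]
    exact congrArg (homMk _) (MonoidalCategory.id_whiskerRight X.obj Y.obj)
  associator_naturality {X₁ X₂ X₃ Y₁ Y₂ Y₃} f₁ f₂ f₃ := by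
    induction f₁ using hom_induction with
    | zero => simp only [zero_tensorHom, zero_comp, comp_zero]
    | add f f' h h' => simp only [add_tensorHom, Preadditive.add_comp, Preadditive.comp_add, h, h']
    | mk a f₁ =>
    induction f₂ using hom_induction with
    | zero => simp only [zero_tensorHom, tensorHom_zero, zero_comp, comp_zero]
    | add f f' h h' => simp only [add_tensorHom, tensorHom_add, Preadditive.add_comp,
        Preadditive.comp_add, h, h']
    | mk b f₂ =>
    induction f₃ using hom_induction with
    | zero => simp only [tensorHom_zero, zero_comp, comp_zero]
    | add f f' h h' => simp only [tensorHom_add, Preadditive.add_comp, Preadditive.comp_add, h, h']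
    | mk c f₃ =>
    rw [tensorHom_homMk, tensorHom_homMk, tensorHom_homMk, tensorHom_homMk, associator_def,
      associator_def, homMk_comp, homMk_comp, mul_one, one_mul, mul_assoc]
    exact congrArg (homMk _) (MonoidalCategory.associator_naturality f₁ f₂ f₃)
  leftUnitor_naturality {X Y} f := by
    induction f using hom_induction with
    | zero => simp only [whiskerLeft_zero', zero_comp, comp_zero]
    | add f f' h h' => simp only [whiskerLeft_add', Preadditive.add_comp, Preadditive.comp_add,
        h, h']
    | mk a f =>
    rw [whiskerLeft_homMk, leftUnitor_def, leftUnitor_def, homMk_comp, homMk_comp, mul_one,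
      one_mul]
    exact congrArg (homMk _) (MonoidalCategory.leftUnitor_naturality f)
  rightUnitor_naturality {X Y} f := by
    induction f using hom_induction with
    | zero => simp only [zero_whiskerRight', zero_comp, comp_zero]
    | add f f' h h' => simp only [add_whiskerRight', Preadditive.add_comp, Preadditive.comp_add,
        h, h']
    | mk a f =>
    rw [homMk_whiskerRight, rightUnitor_def, rightUnitor_def, homMk_comp, homMk_comp, mul_one,
      one_mul]
    exact congrArg (homMk _) (MonoidalCategory.rightUnitor_naturality f)
  pentagon W X Y Z := by
    simp only [associator_def, homMk_whiskerRight, whiskerLeft_homMk, homMk_comp, one_mul]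
    exact congrArg (homMk _) (MonoidalCategory.pentagon W.obj X.obj Y.obj Z.obj)
  triangle X Y := by
    simp only [associator_def, leftUnitor_def, rightUnitor_def, homMk_whiskerRight,
      whiskerLeft_homMk, homMk_comp, one_mul]
    exact congrArg (homMk _) (MonoidalCategory.triangle X.obj Y.obj)

instance : MonoidalPreadditive (ScalarExtension R S C) where
  whiskerLeft_zero := whiskerLeft_zero' _ _ _
  zero_whiskerRight := zero_whiskerRight' _ _ _
  whiskerLeft_add := whiskerLeft_add' _
  add_whiskerRight := add_whiskerRight' _

instance : MonoidalLinear S (ScalarExtension R S C) where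
  whiskerLeft_smul X Y Z r f := by
    induction f using hom_induction with
    | zero => simp only [smul_zero, whiskerLeft_zero']
    | add f f' h h' => simp only [smul_add, whiskerLeft_add', h, h']
    | mk s f => rfl
  smul_whiskerRight r Y Z f X := by
    induction f using hom_induction with
    | zero => simp only [smul_zero, zero_whiskerRight']
    | add f f' h h' => simp only [smul_add, add_whiskerRight', h, h']
    | mk s f => rfl

end ScalarExtension

attribute [local instance] Abelian.hasFiniteBiproducts
attribute [local instance] hasBinaryBiproducts_of_finite_biproducts

/-! ### Tensor categories, fusion categories, tensor equivalences -/

/-- `S`-linear tensor equivalence: there is an `S`-linear strong monoidal functor `C ⥤ D` that is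
an equivalence of categories. -/
def TensorEquivalent (S : Type*) [CommRing S] (C : Type u₁) (D : Type u₂)
    [Category.{v₁} C] [Preadditive C] [Linear S C] [MonoidalCategory C]
    [Category.{v₂} D] [Preadditive D] [Linear S D] [MonoidalCategory D] : Prop :=
  ∃ (F : C ⥤ D) (_ : F.Monoidal), F.IsEquivalence ∧ F.Additive ∧ F.Linear S

/-- A semisimple rigid tensor category over an (algebraically closed) field `k`: a `k`-linear
abelian rigid monoidal category with bilinear tensor product and finite dimensional spaces of
morphisms, in which the unit object is simple and every object is a finite direct sum of simple
objects. -/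
class IsSemisimpleTensorCategory (k : Type*) [Field k] (C : Type u) [Category.{v} C] [Abelian C]
    [Linear k C] [MonoidalCategory C] [MonoidalPreadditive C] [MonoidalLinear k C]
    [RigidCategory C] : Prop where
  finiteDimensional_hom : ∀ X Y : C, FiniteDimensional k (X ⟶ Y)
  simple_unit : Simple (𝟙_ C)
  semisimple : ∀ X : C, ∃ (n : ℕ) (s : Fin n → C), (∀ i, Simple (s i)) ∧ Nonempty (X ≅ ⨁ s)

/-- A fusion category over `k`: a semisimple rigid tensor category over `k` with only finitely
many simple objects up to isomorphism. -/
class IsFusionCategory (k : Type*) [Field k] (C : Type u) [Category.{v} C] [Abelian C]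
    [Linear k C] [MonoidalCategory C] [MonoidalPreadditive C] [MonoidalLinear k C]
    [RigidCategory C] : Prop extends IsSemisimpleTensorCategory k C where
  finite_simple : ∃ (n : ℕ) (s : Fin n → C), ∀ X : C, Simple X → ∃ i, Nonempty (X ≅ s i)

/-- A semisimple rigid tensor category over a local ring `R`: an `R`-linear additive rigid monoidal
category with bilinear tensor product, which as an `R`-linear category is a direct sum of copies
of the category of free `R`-modules of finite rank (one for each index `i`, generated by an
object `x i`), and whose unit object has endomorphism ring `R`. -/
class IsSemisimpleTensorCategoryOverRing (R : Type*) [CommRing R] (C : Type u) [Category.{v} C]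
    [Preadditive C] [HasFiniteBiproducts C] [Linear R C] [MonoidalCategory C]
    [MonoidalPreadditive C] [MonoidalLinear R C] [RigidCategory C] : Prop where
  end_unit : Function.Bijective fun r : R => r • 𝟙 (𝟙_ C)
  split : ∃ (I : Type u) (x : I → C),
    (∀ i, Function.Bijective fun r : R => r • 𝟙 (x i)) ∧
    (∀ i j, i ≠ j → ∀ f : x i ⟶ x j, f = 0) ∧
    ∀ X : C, ∃ (n : ℕ) (a : Fin n → I), Nonempty (X ≅ ⨁ fun m => x (a m))

/-! ### The Grothendieck ring -/

section GrothendieckRing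

variable (C : Type u) [Category.{v} C] [Preadditive C] [HasFiniteBiproducts C]
  [MonoidalCategory C]

/-- The relations `[X ⊕ Y] = [X] + [Y]` in the free abelian group on isomorphism classes of
objects. -/
inductive GrothendieckRel : FreeAbelianGroup (Skeleton C) → FreeAbelianGroup (Skeleton C) → Prop
  | biprod (X Y : C) : GrothendieckRel (.of (toSkeleton (X ⊞ Y)))
      (.of (toSkeleton X) + .of (toSkeleton Y))

/-- The Grothendieck ring of a semisimple tensor category (in which all short exact sequences
split): generated by the classes `[X]` of objects, with `[X ⊕ Y] = [X] + [Y]` and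
`[X] * [Y] = [X ⊗ Y]`, `1 = [𝟙]`. -/
abbrev GrothendieckRing := RingQuot (GrothendieckRel C)

variable {C} in
/-- The class of an object in the Grothendieck ring. -/
noncomputable def grothendieckClass (X : C) : GrothendieckRing C :=
  RingQuot.mkRingHom (GrothendieckRel C) (.of (toSkeleton X))

/-- The basis of the Grothendieck ring formed by the classes of simple objects. -/
def simpleClasses : Set (GrothendieckRing C) :=
  {a | ∃ X : C, Simple X ∧ a = grothendieckClass X}

end GrothendieckRing

/-- `C` and `D` have the same Grothendieck ring, as rings with basis. -/
def SameGrothendieckRing (C : Type u₁) (D : Type u₂)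
    [Category.{v₁} C] [Preadditive C] [HasFiniteBiproducts C] [MonoidalCategory C]
    [Category.{v₂} D] [Preadditive D] [HasFiniteBiproducts D] [MonoidalCategory D] : Prop :=
  ∃ e : GrothendieckRing C ≃+* GrothendieckRing D, e '' simpleClasses C = simpleClasses D

/-! ### Good and bad primes -/

/-- The field of algebraic numbers. -/
abbrev QBar : Type := AlgebraicClosure ℚ

/-- The ring of integers of the algebraic closure of `ℚ_p`. -/
abbrev ZpBar (p : ℕ) [Fact p.Prime] : Type := 𝒪[PadicAlgCl p]

/-- The residue field of the ring of integers of the algebraic closure of `ℚ_p`, which is an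
algebraic closure of `𝔽_p`. -/
abbrev FpBar (p : ℕ) [Fact p.Prime] : Type := IsLocalRing.ResidueField (ZpBar p)

/-- A good reduction modulo `p` of a semisimple rigid tensor category `C` over `QBar`, with respect
to an embedding `ι` of `QBar` into the algebraic closure of `ℚ_p`. -/
structure GoodReduction (p : ℕ) [Fact p.Prime] (ι : QBar →+* PadicAlgCl p)
    (C : Type u) [Category.{v} C] [Abelian C] [Linear QBar C] [MonoidalCategory C]
    [MonoidalPreadditive C] [MonoidalLinear QBar C] [RigidCategory C] where
  /-- the reduction, over `FpBar p` -/
  red : Type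
  [category_red : Category.{0} red]
  [abelian_red : Abelian red]
  [linear_red : Linear (FpBar p) red]
  [monoidalCategory_red : MonoidalCategory red]
  [monoidalPreadditive_red : MonoidalPreadditive red]
  [monoidalLinear_red : MonoidalLinear (FpBar p) red]
  [rigidCategory_red : RigidCategory red]
  [isSemisimple_red : IsSemisimpleTensorCategory (FpBar p) red]
  sameGrothendieckRing : SameGrothendieckRing red C
  /-- the lift of the reduction, over `ZpBar p` -/
  lift : Type
  [category_lift : Category.{0} lift]
  [preadditive_lift : Preadditive lift]
  [hasFiniteBiproducts_lift : HasFiniteBiproducts lift]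
  [linear_lift : Linear (ZpBar p) lift]
  [monoidalCategory_lift : MonoidalCategory lift]
  [monoidalPreadditive_lift : MonoidalPreadditive lift]
  [monoidalLinear_lift : MonoidalLinear (ZpBar p) lift]
  [rigidCategory_lift : RigidCategory lift]
  [isSemisimple_lift : IsSemisimpleTensorCategoryOverRing (ZpBar p) lift]
  reduction : TensorEquivalent (FpBar p) (ScalarExtension (ZpBar p) (FpBar p) lift) red
  generic : letI := ι.toAlgebra
    TensorEquivalent (PadicAlgCl p) (ScalarExtension (ZpBar p) (PadicAlgCl p) lift)
      (ScalarExtension QBar (PadicAlgCl p) C)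

/-- `p` is a good prime for `C` if a good reduction of `C` modulo `p` exists. -/
def IsGoodPrime (p : ℕ) [Fact p.Prime] (ι : QBar →+* PadicAlgCl p)
    (C : Type u) [Category.{v} C] [Abelian C] [Linear QBar C] [MonoidalCategory C]
    [MonoidalPreadditive C] [MonoidalLinear QBar C] [RigidCategory C] : Prop :=
  Nonempty (GoodReduction p ι C)

/-- `p` is a bad prime for `C` if it is not good. -/
def IsBadPrime (p : ℕ) [Fact p.Prime] (ι : QBar →+* PadicAlgCl p)
    (C : Type u) [Category.{v} C] [Abelian C] [Linear QBar C] [MonoidalCategory C]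
    [MonoidalPreadditive C] [MonoidalLinear QBar C] [RigidCategory C] : Prop :=
  ¬ IsGoodPrime p ι C

/-! A fusion category is described by finitely many algebraic numbers. Choose representatives of the
simple objects and decompositions of the unit and of the products of two representatives. The
associators, the unitors, their inverses and the evaluations and coevaluations of the
representatives then become finitely many matrices over `QBar`. An algebraic number becomes an
algebraic integer after multiplication by some nonzero integer, so it is integral under `ι p` for
all but finitely many `p` (`finite_setOf_not_integral`). For almost all `p` every matrix entry
therefore lies in the subring `A` of numbers that are integral under `ι p`. For such `p` the
category has a form over `A` (`exists_finite_isDefinedOver`, `IntegralForm`). Its extension to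
`ZpBar p` is the lift, and the further extension to `FpBar p` is the good reduction
(`FusionBasis.isGoodPrime`). Inverse matrices are included among the data, so structural
isomorphisms stay isomorphisms modulo `p`.

What makes this work is that semisimplicity is encoded by data which survive every base change: a
Schur family stays one (`ScalarExtension.schurFamily`), and a decomposition consists of equations,
which additive functors preserve (`Decomposition.map`). Over a field these data make the category
abelian and semisimple (`SchurFamily.abelian`, `SchurFamily.simple_iff`) and determine isomorphism
classes by multiplicities (`Decomposition.nonempty_iso_iff`). The multiplicities do not change under
reduction, so neither does the Grothendieck ring. A linear functor that carries a Schur family to a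
Schur family is fully faithful (`SchurFamily.full_faithful`), which identifies the generic fibre.

The objects of the integral form are formal words in simple objects, tensor products and direct
sums. Each word carries a decomposition built along its syntax, and the functor to the original
category has identities as its tensor constraints. -/

/-! ### Schur families and decompositions -/

/-- A family of objects with endomorphism rings `R` and no nonzero morphisms between
different members. -/
structure SchurFamily (R : Type*) [CommRing R] {E : Type u} [Category.{v} E] [Preadditive E]
    [Linear R E] {I : Type} (x : I → E) : Prop where
  end_bijective : ∀ i, Function.Bijective fun r : R => r • 𝟙 (x i)
  hom_eq_zero : ∀ i j, i ≠ j → ∀ f : x i ⟶ x j, f = 0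

/-- A decomposition of `X` as a finite direct sum of members of the family `x`. -/
structure Decomposition {E : Type u} [Category.{v} E] [Preadditive E] {I : Type} (x : I → E)
    (X : E) where
  /-- the index set of the summands -/
  J : Type
  [fintype : Fintype J]
  /-- the member of the family which is the summand `j` -/
  index : J → I
  /-- the inclusion of the summand `j` -/
  incl : ∀ j, x (index j) ⟶ X
  /-- the projection to the summand `j` -/
  proj : ∀ j, X ⟶ x (index j)
  incl_proj : ∀ j, incl j ≫ proj j = 𝟙 _
  incl_proj_ne : ∀ j k, j ≠ k → incl j ≫ proj k = 0
  total : ∑ j, proj j ≫ incl j = 𝟙 X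

attribute [instance] Decomposition.fintype
attribute [simp] Decomposition.incl_proj

namespace SchurFamily

variable {R : Type*} [CommRing R] {E : Type u} [Category.{v} E] [Preadditive E] [Linear R E]
  {I : Type} {x : I → E} (hx : SchurFamily R x)

/-- The identification of the endomorphism ring of `x i` with `R`. -/
noncomputable def endEquiv (i : I) : R ≃ₗ[R] (x i ⟶ x i) :=
  LinearEquiv.ofBijective (LinearMap.toSpanSingleton R (x i ⟶ x i) (𝟙 (x i)))
    (hx.end_bijective i)

theorem endEquiv_apply (i : I) (r : R) : hx.endEquiv i r = r • 𝟙 (x i) := rfl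

open Classical in
/-- The coefficient of a morphism between members of a Schur family. -/
noncomputable def coef (i j : I) : (x i ⟶ x j) →ₗ[R] R :=
  if h : i = j then
    (hx.endEquiv i).symm.toLinearMap ∘ₗ Linear.rightComp R (x i) (eqToHom (by rw [h]))
  else 0

theorem coef_smul_id (i : I) (r : R) : hx.coef i i (r • 𝟙 (x i)) = r := by
  rw [← hx.endEquiv_apply]
  simp [coef, -map_smul]

@[simp]
theorem coef_id (i : I) : hx.coef i i (𝟙 (x i)) = 1 := by
  simpa using hx.coef_smul_id i 1

theorem coef_smul_id_self (i : I) (f : x i ⟶ x i) : hx.coef i i f • 𝟙 (x i) = f := by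
  obtain ⟨r, rfl⟩ := (hx.end_bijective i).2 f
  exact congrArg (· • 𝟙 (x i)) (hx.coef_smul_id i r)

theorem coef_ne {i j : I} (h : i ≠ j) (f : x i ⟶ x j) : hx.coef i j f = 0 := by
  simp [coef, h]

theorem coef_injective (i j : I) : Function.Injective (hx.coef i j) := by
  intro f g h
  by_cases hij : i = j
  · subst hij
    rw [← hx.coef_smul_id_self i f, h, hx.coef_smul_id_self]
  · rw [hx.hom_eq_zero i j hij f, hx.hom_eq_zero i j hij g]

/-- Scalars pull out of a composite, and a morphism between distinct members vanishes. This is what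
lets `Decomposition.mat` turn composition into matrix multiplication. -/
theorem coef_comp {i j k : I} (f : x i ⟶ x j) (g : x j ⟶ x k) :
    hx.coef i k (f ≫ g) = hx.coef i j f * hx.coef j k g := by
  by_cases hij : i = j
  · subst hij
    obtain ⟨r, rfl⟩ := (hx.end_bijective i).2 f
    simp
  · rw [hx.hom_eq_zero i j hij f]; simp

end SchurFamily

namespace Decomposition

section

variable {E : Type u} [Category.{v} E] [Preadditive E] {I : Type} {x : I → E}

theorem eq_sum {X Y : E} (d : Decomposition x X) (e : Decomposition x Y) (f : X ⟶ Y) :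
    f = ∑ j, ∑ k, d.proj j ≫ (d.incl j ≫ f ≫ e.proj k) ≫ e.incl k := by
  conv_lhs => rw [← Category.id_comp f, ← d.total, ← Category.comp_id f, ← e.total]
  simp only [Preadditive.sum_comp, Preadditive.comp_sum, Category.assoc]
  exact Finset.sum_comm

theorem hom_ext {X Y : E} (d : Decomposition x X) (e : Decomposition x Y) {f g : X ⟶ Y}
    (h : ∀ j k, d.incl j ≫ f ≫ e.proj k = d.incl j ≫ g ≫ e.proj k) : f = g := by
  rw [d.eq_sum e f, d.eq_sum e g]; simp only [h]

theorem hom_ext_proj {X : E} (d : Decomposition x X) {Z : E} {f g : Z ⟶ X}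
    (h : ∀ j, f ≫ d.proj j = g ≫ d.proj j) : f = g := by
  rw [← Category.comp_id f, ← Category.comp_id g, ← d.total, Preadditive.comp_sum,
    Preadditive.comp_sum]
  simp only [← Category.assoc, h]

theorem incl_comp_sum {X : E} (d : Decomposition x X) {Z : E} (f : ∀ j, x (d.index j) ⟶ Z)
    (j : d.J) :
    d.incl j ≫ ∑ j', d.proj j' ≫ f j' = f j := by
  rw [Preadditive.comp_sum, Finset.sum_eq_single j]
  · rw [← Category.assoc, d.incl_proj, Category.id_comp]
  · intro k _ hk
    rw [← Category.assoc, d.incl_proj_ne _ _ hk.symm, zero_comp]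
  · simp

theorem sum_comp_proj {X : E} (d : Decomposition x X) {Z : E} (f : ∀ j, Z ⟶ x (d.index j))
    (j : d.J) :
    (∑ j', f j' ≫ d.incl j') ≫ d.proj j = f j := by
  rw [Preadditive.sum_comp, Finset.sum_eq_single j]
  · rw [Category.assoc, d.incl_proj, Category.comp_id]
  · intro k _ hk
    rw [Category.assoc, d.incl_proj_ne _ _ hk, comp_zero]
  · simp

/-- The image of a decomposition under an additive functor. -/
def map {X : E} (d : Decomposition x X) {E' : Type u₁} [Category.{v₁} E'] [Preadditive E']
    (G : E ⥤ E') [G.Additive] : Decomposition (fun i => G.obj (x i)) (G.obj X) where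
  J := d.J
  index := d.index
  incl j := G.map (d.incl j)
  proj j := G.map (d.proj j)
  incl_proj j := by rw [← G.map_comp, d.incl_proj, G.map_id]
  incl_proj_ne j k h := by rw [← G.map_comp, d.incl_proj_ne j k h, G.map_zero]
  total := by simp only [← G.map_comp, ← G.map_sum, d.total, G.map_id]

/-- Transport of a decomposition along an isomorphism. -/
def ofIso {X Y : E} (d : Decomposition x X) (e : X ≅ Y) : Decomposition x Y where
  J := d.J
  index := d.index
  incl j := d.incl j ≫ e.hom
  proj j := e.inv ≫ d.proj j
  incl_proj j := by simp
  incl_proj_ne j k h := by simp [d.incl_proj_ne j k h]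
  total := by
    have : ∑ j, (e.inv ≫ d.proj j) ≫ d.incl j ≫ e.hom =
        e.inv ≫ (∑ j, d.proj j ≫ d.incl j) ≫ e.hom := by
      simp [Preadditive.sum_comp, Preadditive.comp_sum]
    rw [this, d.total]; simp

/-- A member of the family is its own decomposition. -/
def single (x : I → E) (i : I) : Decomposition x (x i) where
  J := Unit
  index _ := i
  incl _ := 𝟙 _
  proj _ := 𝟙 _
  incl_proj _ := by simp
  incl_proj_ne j k h := (h rfl).elim
  total := by simp

/-- The tautological decomposition of a direct sum. -/
noncomputable def biproduct (x : I → E) {J : Type} [Fintype J] (a : J → I)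
    [HasBiproduct fun j => x (a j)] :
    Decomposition x (⨁ fun j => x (a j)) where
  J := J
  index := a
  incl j := biproduct.ι (fun j => x (a j)) j
  proj j := biproduct.π (fun j => x (a j)) j
  incl_proj j := by simp
  incl_proj_ne j k h := biproduct.ι_π_ne _ h
  total := biproduct.total

/-- The decomposition of a direct sum of decomposed objects. -/
noncomputable def sum {n : ℕ} {X : Fin n → E} [HasBiproduct X] (d : ∀ m, Decomposition x (X m)) :
    Decomposition x (⨁ X) where
  J := Σ m, (d m).J
  index j := (d j.1).index j.2
  incl j := (d j.1).incl j.2 ≫ biproduct.ι X j.1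
  proj j := biproduct.π X j.1 ≫ (d j.1).proj j.2
  incl_proj j := by simp
  incl_proj_ne j k h := by
    obtain ⟨j₁, j₂⟩ := j
    obtain ⟨k₁, k₂⟩ := k
    by_cases hjk : j₁ = k₁
    · subst hjk
      have : j₂ ≠ k₂ := fun h' => h (by rw [h'])
      simp [(d j₁).incl_proj_ne _ _ this]
    · simp [biproduct.ι_π_ne_assoc X hjk]
  total := by
    rw [Fintype.sum_sigma, ← biproduct.total]
    refine Finset.sum_congr rfl fun m _ => ?_
    have : ∑ j, (biproduct.π X m ≫ (d m).proj j) ≫ (d m).incl j ≫ biproduct.ι X m =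
        biproduct.π X m ≫ (∑ j, (d m).proj j ≫ (d m).incl j) ≫ biproduct.ι X m := by
      simp [Preadditive.sum_comp, Preadditive.comp_sum]
    rw [this, (d m).total, Category.id_comp]

/-- Objects with the same summands are isomorphic. -/
def isoOfEquiv {X Y : E} (d : Decomposition x X) (e : Decomposition x Y) (σ : d.J ≃ e.J)
    (h : ∀ j, e.index (σ j) = d.index j) : X ≅ Y where
  hom := ∑ j, d.proj j ≫ eqToHom (by rw [h]) ≫ e.incl (σ j)
  inv := ∑ j, e.proj (σ j) ≫ eqToHom (by rw [h]) ≫ d.incl j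
  hom_inv_id := by
    refine d.hom_ext d fun j k => ?_
    rw [← Category.assoc, ← Category.assoc, d.incl_comp_sum, Category.assoc, Category.assoc,
      Preadditive.sum_comp, Preadditive.comp_sum, Finset.sum_eq_single j]
    · simp [reassoc_of% e.incl_proj]
    · intro l _ hl
      have := e.incl_proj_ne (σ j) (σ l) fun h => hl (σ.injective h).symm
      simp [reassoc_of% this]
    · simp
  inv_hom_id := by
    have : ∀ j, (∑ j, e.proj (σ j) ≫ eqToHom (by rw [h]) ≫ d.incl j) ≫
        d.proj j ≫ eqToHom (by rw [h]) ≫ e.incl (σ j) = e.proj (σ j) ≫ e.incl (σ j) := by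
      intro j
      have := d.sum_comp_proj (fun j => e.proj (σ j) ≫ eqToHom (by rw [h])) j
      simp only [Category.assoc] at this
      rw [reassoc_of% this]
      simp
    rw [Preadditive.comp_sum, Finset.sum_congr rfl fun j _ => this j,
      σ.sum_comp fun j => e.proj j ≫ e.incl j, e.total]

/-- Passes from an arbitrary finite index type to the `Fin n`-indexed direct sums that the
definitions of semisimplicity ask for. -/
theorem exists_fin_biproduct [HasFiniteBiproducts E] {X : E} (d : Decomposition x X) :
    ∃ (n : ℕ) (a : Fin n → I), Nonempty (X ≅ ⨁ fun m => x (a m)) :=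
  ⟨_, d.index ∘ (Fintype.equivFin d.J).symm, ⟨d.isoOfEquiv
    (.biproduct x (d.index ∘ (Fintype.equivFin d.J).symm)) (Fintype.equivFin d.J)
      fun j => congrArg d.index ((Fintype.equivFin d.J).symm_apply_apply j)⟩⟩

end

section

variable {R : Type*} [CommRing R] {E : Type u} [Category.{v} E] [Preadditive E] [Linear R E]
  {I : Type} {x : I → E} (hx : SchurFamily R x)

/-- The matrix of a morphism with respect to decompositions of source and target. -/
noncomputable def mat {X Y : E} (d : Decomposition x X) (e : Decomposition x Y) :
    (X ⟶ Y) →ₗ[R] Matrix d.J e.J R where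
  toFun f := .of fun j k => hx.coef _ _ (d.incl j ≫ f ≫ e.proj k)
  map_add' f g := by ext; simp
  map_smul' r f := by ext; simp

theorem mat_apply {X Y : E} (d : Decomposition x X) (e : Decomposition x Y) (f : X ⟶ Y)
    (j : d.J) (k : e.J) : mat hx d e f j k = hx.coef _ _ (d.incl j ≫ f ≫ e.proj k) := rfl

theorem mat_injective {X Y : E} (d : Decomposition x X) (e : Decomposition x Y) :
    Function.Injective (mat hx d e) := fun _ _ h =>
  d.hom_ext e fun j k => hx.coef_injective _ _ (congrFun (congrFun h j) k)

/-- Inserting `e.total` between the two factors produces the sum over the middle index. -/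
theorem mat_comp {X Y Z : E} (d : Decomposition x X) (e : Decomposition x Y)
    (c : Decomposition x Z) (f : X ⟶ Y) (g : Y ⟶ Z) :
    mat hx d c (f ≫ g) = mat hx d e f * mat hx e c g := by
  ext j k
  simp only [Matrix.mul_apply, mat_apply, ← hx.coef_comp, ← map_sum]
  congr 1
  conv_lhs => rw [← Category.id_comp g, ← e.total]
  simp [Preadditive.sum_comp, Preadditive.comp_sum]

end

end Decomposition

/-- A linear functor that preserves a Schur family by which all objects of the source decompose
is fully faithful. -/
theorem SchurFamily.full_faithful {R : Type*} [CommRing R] {E : Type u} [Category.{v} E]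
    [Preadditive E] [Linear R E] {E' : Type u₁} [Category.{v₁} E'] [Preadditive E'] [Linear R E']
    {I : Type} {x : I → E} (hx : SchurFamily R x) (hd : ∀ X, Nonempty (Decomposition x X))
    (G : E ⥤ E') [G.Additive] [G.Linear R] (hG : SchurFamily R fun i => G.obj (x i)) :
    G.Full ∧ G.Faithful := by
  have key : ∀ i j, Function.Bijective (G.map : (x i ⟶ x j) → _) := by
    intro i j
    by_cases hij : i = j
    · subst hij
      -- Composed with the bijection `r ↦ r • 𝟙`, the map `G.map` becomes `r ↦ r • 𝟙` for the image
      -- family, which is bijective by `hG`.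
      refine ((hx.end_bijective i).of_comp_iff _).1 ?_
      convert! hG.end_bijective i using 2 with r
      simp [Functor.map_smul]
    · refine ⟨fun f g _ => ?_, fun f => ⟨0, ?_⟩⟩
      · rw [hx.hom_eq_zero i j hij f, hx.hom_eq_zero i j hij g]
      · rw [hG.hom_eq_zero i j hij f, G.map_zero]
  refine ⟨⟨fun {X Y} g => ?_⟩, ⟨fun {X Y} f g h => ?_⟩⟩
  · obtain ⟨d⟩ := hd X
    obtain ⟨e⟩ := hd Y
    choose f hf using fun j k => (key (d.index j) (e.index k)).2
      ((d.map G).incl j ≫ g ≫ (e.map G).proj k)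
    refine ⟨∑ j, ∑ k, d.proj j ≫ f j k ≫ e.incl k, ?_⟩
    rw [(d.map G).eq_sum (e.map G) g]
    simp only [G.map_sum, G.map_comp, hf]
    rfl
  · obtain ⟨d⟩ := hd X
    obtain ⟨e⟩ := hd Y
    refine d.hom_ext e fun j k => (key _ _).1 ?_
    simp only [G.map_comp, h]

/-! ### Semisimple categories over a field -/

section

variable {k : Type*} [Field k] {E : Type u} [Category.{v} E] [Preadditive E] [Linear k E]
  {I : Type} {x : I → E}

namespace Decomposition

open Classical in
/-- The morphisms from `x i` to `X` form a vector space with one coordinate for each summand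
`x i` of `X`. -/
noncomputable def homEquiv (hx : SchurFamily k x) {X : E} (d : Decomposition x X) (i : I) :
    (x i ⟶ X) ≃ₗ[k] ({j : d.J // d.index j = i} → k) :=
  LinearEquiv.ofBijective
    (LinearMap.pi fun j : {j : d.J // d.index j = i} =>
      hx.coef i (d.index j) ∘ₗ Linear.rightComp k (x i) (d.proj j)) <| by
    refine ⟨fun f g h => d.hom_ext_proj fun j => hx.coef_injective _ _ ?_, fun v => ?_⟩
    · by_cases hj : d.index j = i
      · exact congrFun h (⟨j, hj⟩ : {j : d.J // d.index j = i})
      · exact (hx.coef_ne (Ne.symm hj) _).trans (hx.coef_ne (Ne.symm hj) _).symm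
    · refine ⟨∑ j, (if h : d.index j = i then v ⟨j, h⟩ • eqToHom (by rw [h]) else 0) ≫ d.incl j,
        ?_⟩
      ext ⟨j, rfl⟩
      exact (congrArg (hx.coef _ _) (d.sum_comp_proj _ j)).trans (by simp)

theorem finrank_hom (hx : SchurFamily k x) {X : E} (d : Decomposition x X) (i : I) :
    Module.finrank k (x i ⟶ X) = Nat.card {j : d.J // d.index j = i} := by
  classical
  rw [(d.homEquiv hx i).finrank_eq, Module.finrank_fintype_fun_eq_card, Nat.card_eq_fintype_card]

theorem finiteDimensional_hom (hx : SchurFamily k x) {X : E} (d : Decomposition x X) (i : I) :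
    FiniteDimensional k (x i ⟶ X) :=
  (d.homEquiv hx i).symm.finiteDimensional

theorem finiteDimensional_hom' (hx : SchurFamily k x) {X Y : E} (d : Decomposition x X)
    (e : Decomposition x Y) : FiniteDimensional k (X ⟶ Y) :=
  FiniteDimensional.of_injective _ (mat_injective hx d e)

/-- The multiplicities of the summands are determined by the isomorphism class. -/
theorem nonempty_iso_iff (hx : SchurFamily k x) {X Y : E} (d : Decomposition x X)
    (e : Decomposition x Y) :
    Nonempty (X ≅ Y) ↔ ∃ σ : d.J ≃ e.J, ∀ j, e.index (σ j) = d.index j := by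
  classical
  refine ⟨fun ⟨f⟩ => ?_, fun ⟨σ, h⟩ => ⟨d.isoOfEquiv e σ h⟩⟩
  -- The number of summands of type `i` is the dimension of the space of morphisms from `x i`, an
  -- isomorphism invariant. The bijections of fibres are then glued over all `i`.
  have key : ∀ i, Nonempty ({j // d.index j = i} ≃ {j // e.index j = i}) := fun i => by
    rw [← Finite.card_eq, ← d.finrank_hom hx i, ← e.finrank_hom hx i]
    exact (Linear.homCongr k (Iso.refl (x i)) f).finrank_eq
  refine ⟨(Equiv.sigmaFiberEquiv d.index).symm.trans
    ((Equiv.sigmaCongrRight fun i => (key i).some).trans (Equiv.sigmaFiberEquiv e.index)),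
    fun j => ?_⟩
  exact ((key (d.index j)).some ⟨j, rfl⟩).2

end Decomposition

namespace SchurFamily

theorem id_ne_zero (hx : SchurFamily k x) (i : I) : 𝟙 (x i) ≠ 0 := fun h =>
  one_ne_zero (α := k) ((hx.end_bijective i).1 (by simp [h]))

/-- A nonzero monomorphism into `x i` has a nonzero component on some summand of its source. That
summand must be `x i`, the component is a nonzero and hence invertible scalar, and so the
monomorphism is a split epimorphism. -/
theorem simple (hx : SchurFamily k x) (hd : ∀ X, Nonempty (Decomposition x X)) (i : I) :
    Simple (x i) where
  mono_isIso_iff_nonzero {Y} f _ := by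
    refine ⟨fun hf h => hx.id_ne_zero i ?_, fun hf => ?_⟩
    · rw [← IsIso.inv_hom_id f]; simp only [h, comp_zero]
    · obtain ⟨d⟩ := hd Y
      obtain ⟨j, hj⟩ : ∃ j, d.incl j ≫ f ≠ 0 := by
        by_contra! h
        apply hf
        rw [← Category.id_comp f, ← d.total, Preadditive.sum_comp]
        simp [h]
      obtain rfl : d.index j = i := by
        by_contra h
        exact hj (hx.hom_eq_zero _ _ h _)
      obtain ⟨r, hr⟩ := (hx.end_bijective _).2 (d.incl j ≫ f)
      have hr0 : r ≠ 0 := by rintro rfl; exact hj (by simpa using hr.symm)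
      have : IsSplitEpi f := ⟨⟨⟨r⁻¹ • d.incl j, by
        rw [Linear.smul_comp, ← hr, smul_smul, inv_mul_cancel₀ hr0, one_smul]⟩⟩⟩
      exact isIso_of_mono_of_isSplitEpi f

/-- A simple object is nonzero, so it has a summand; the inclusion of this summand is a nonzero
monomorphism into a simple object. -/
theorem exists_iso_of_simple (hx : SchurFamily k x) (hd : ∀ X, Nonempty (Decomposition x X))
    (X : E) [Simple X] : ∃ i, Nonempty (X ≅ x i) := by
  obtain ⟨d⟩ := hd X
  have hX : 𝟙 X ≠ 0 := id_nonzero X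
  have : Nonempty d.J := by
    by_contra h
    rw [not_nonempty_iff] at h
    exact hX (by rw [← d.total]; simp)
  obtain ⟨j⟩ := this
  have hm : IsSplitMono (d.incl j) := ⟨⟨⟨d.proj j, d.incl_proj j⟩⟩⟩
  have : IsIso (d.incl j) := isIso_of_mono_of_nonzero fun h => hx.id_ne_zero (d.index j) <| by
    rw [← d.incl_proj j, h, zero_comp]
  exact ⟨_, ⟨(asIso (d.incl j)).symm⟩⟩

theorem simple_iff (hx : SchurFamily k x) (hd : ∀ X, Nonempty (Decomposition x X)) (X : E) :
    Simple X ↔ ∃ i, Nonempty (X ≅ x i) := by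
  refine ⟨fun _ => hx.exists_iso_of_simple hd X, fun ⟨i, ⟨e⟩⟩ => ?_⟩
  have := hx.simple hd i
  exact Simple.of_iso e

end SchurFamily

end

/-! ### Abelian structure, transported from families of finite dimensional vector spaces -/

namespace SchurFamily

variable {k : Type v} [Field k] {E : Type u} [Category.{v} E] [Preadditive E] [Linear k E]
  {I : Type} {x : I → E}

/-- The functor that sends an object to its spaces of morphisms from the members of a family. -/
noncomputable def multiplicity (hx : SchurFamily k x) (hd : ∀ X, Nonempty (Decomposition x X)) :
    E ⥤ (Discrete I ⥤ FGModuleCat.{v} k) :=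
  have := fun i X => (hd X).some.finiteDimensional_hom hx i
  { obj := fun X => Discrete.functor fun i => FGModuleCat.of k (x i ⟶ X)
    map := fun f => Discrete.natTrans fun ⟨i⟩ => FGModuleCat.ofHom (Linear.rightComp k (x i) f)
    map_id := fun X => by
      ext ⟨i⟩ g
      exact Category.comp_id g
    map_comp := fun f g => by
      ext ⟨i⟩ h
      exact (Category.assoc _ _ _).symm }

theorem multiplicity_faithful (hx : SchurFamily k x) (hd : ∀ X, Nonempty (Decomposition x X)) :
    (hx.multiplicity hd).Faithful where
  map_injective {X Y} f g h := by
    obtain ⟨d⟩ := hd X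
    have key : ∀ i (a : x i ⟶ X), a ≫ f = a ≫ g := fun i a =>
      congrArg (fun t => (t.app ⟨i⟩).hom.hom a) h
    rw [← Category.id_comp f, ← Category.id_comp g, ← d.total]
    simp [Preadditive.sum_comp, key]

/-- A morphism out of `X` is fixed by its values on the inclusions, so the candidate preimage sends
each `d.incl j` where `φ` does. Agreement with `φ` on every morphism from `x i` follows because each
component of such a morphism is a scalar or zero, and `φ` is linear. -/
theorem multiplicity_full (hx : SchurFamily k x) (hd : ∀ X, Nonempty (Decomposition x X)) :
    (hx.multiplicity hd).Full where
  map_surjective {X Y} φ := by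
    obtain ⟨d⟩ := hd X
    let ψ (i : I) : (x i ⟶ X) →ₗ[k] (x i ⟶ Y) := (φ.app ⟨i⟩).hom.hom
    refine ⟨∑ j, d.proj j ≫ ψ _ (d.incl j), ?_⟩
    ext ⟨i⟩ (a : x i ⟶ X)
    change a ≫ ∑ j, d.proj j ≫ ψ _ (d.incl j) = ψ i a
    have ha : a = ∑ j, (a ≫ d.proj j) ≫ d.incl j := by
      conv_lhs => rw [← Category.comp_id a, ← d.total]
      simp [Preadditive.comp_sum]
    conv_rhs => rw [ha, map_sum]
    rw [Preadditive.comp_sum]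
    refine Finset.sum_congr rfl fun j _ => ?_
    rw [← Category.assoc]
    generalize a ≫ d.proj j = b
    by_cases hij : i = d.index j
    · subst hij
      obtain ⟨r, rfl⟩ := (hx.end_bijective _).2 b
      simp
    · rw [hx.hom_eq_zero _ _ hij b]; simp

/-- The direct sum in which `x i` occurs as often as the dimension of the `i`-th space has the
prescribed multiplicity spaces. Finiteness of `I` is what makes this sum finite. -/
theorem multiplicity_essSurj [Finite I] [HasFiniteBiproducts E] (hx : SchurFamily k x)
    (hd : ∀ X, Nonempty (Decomposition x X)) : (hx.multiplicity hd).EssSurj where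
  mem_essImage W := by
    have := Fintype.ofFinite I
    let J := Σ i : I, Fin (Module.finrank k (W.obj ⟨i⟩))
    have : HasBiproduct fun j : J => x j.1 := HasBiproductsOfShape.has_biproduct _
    let d := Decomposition.biproduct x (J := J) fun j => j.1
    have hfin := fun i X => (hd X).some.finiteDimensional_hom hx i
    have key : ∀ i, Nonempty ((x i ⟶ ⨁ fun j : J => x j.1) ≃ₗ[k] W.obj ⟨i⟩) := fun i => by
      refine FiniteDimensional.nonempty_linearEquiv_of_finrank_eq ?_
      rw [d.finrank_hom hx i]
      exact (Nat.card_congr (Equiv.sigmaSubtype i)).trans (Nat.card_fin _)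
    exact ⟨⨁ fun j : J => x j.1, ⟨Discrete.natIso fun ⟨i⟩ => (key i).some.toFGModuleCatIso⟩⟩

/-- A linear category with finite direct sums, in which every object decomposes according to a
finite Schur family over a field, is abelian. -/
@[reducible]
noncomputable def abelian [Finite I] [HasFiniteBiproducts E] (hx : SchurFamily k x)
    (hd : ∀ X, Nonempty (Decomposition x X)) : Abelian E :=
  have := hx.multiplicity_faithful hd
  have := hx.multiplicity_full hd
  have := hx.multiplicity_essSurj hd
  have : (hx.multiplicity hd).IsEquivalence := {}
  abelianOfEquivalence (hx.multiplicity hd)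

end SchurFamily

/-! ### Functors and structure on extensions of scalars -/

namespace ScalarExtension

section Linear

variable {R : Type*} [CommRing R] {S : Type w} [CommRing S] [Algebra R S]
variable {C : Type u} [Category.{v} C] [Preadditive C] [Linear R C]

theorem homMk_add {X Y : ScalarExtension R S C} (s : S) (f g : X.obj ⟶ Y.obj) :
    (homMk s (f + g) : X ⟶ Y) = homMk s f + homMk s g :=
  TensorProduct.tmul_add s f g

@[simp]
theorem homMk_zero {X Y : ScalarExtension R S C} (s : S) : (homMk s 0 : X ⟶ Y) = 0 :=
  TensorProduct.tmul_zero _ s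

theorem smul_homMk {X Y : ScalarExtension R S C} (s t : S) (f : X.obj ⟶ Y.obj) :
    s • (homMk t f : X ⟶ Y) = homMk (s * t) f := rfl

theorem homMk_smul {X Y : ScalarExtension R S C} (r : R) (s : S) (f : X.obj ⟶ Y.obj) :
    (homMk s (r • f) : X ⟶ Y) = homMk (r • s) f :=
  (TensorProduct.smul_tmul r s f).symm

variable (R S C) in
/-- The canonical functor to the extension of scalars. -/
noncomputable def incl : C ⥤ ScalarExtension R S C where
  obj X := ⟨X⟩
  map f := homMk 1 f
  map_id X := rfl
  map_comp f g := by rw [homMk_comp, one_mul]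

instance : (incl R S C).Additive where
  map_add {_ _ f g} := homMk_add 1 f g

/-- Tensoring `End (x i) ≅ R` with `S` gives `S`, and tensoring a zero module gives zero. No
flatness is involved, so reduction to the residue field is covered as well as passage to the generic
fibre. -/
theorem schurFamily {I : Type} {x : I → C} (hx : SchurFamily R x) :
    SchurFamily S fun i => (incl R S C).obj (x i) where
  end_bijective i := by
    have : (fun s : S => s • 𝟙 ((incl R S C).obj (x i))) =
        ((TensorProduct.rid R S).symm ≪≫ₗ (hx.endEquiv i).lTensor S) := by
      ext s
      change s • (homMk 1 (𝟙 _) : (⟨x i⟩ : ScalarExtension R S C) ⟶ ⟨x i⟩) =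
        homMk (X := ⟨x i⟩) (Y := ⟨x i⟩) s ((1 : R) • 𝟙 (x i))
      rw [smul_homMk, mul_one, one_smul]
    rw [this]
    exact LinearEquiv.bijective _
  hom_eq_zero i j hij f := by
    induction f using hom_induction with
    | zero => rfl
    | mk s f => exact (congrArg (homMk s) (hx.hom_eq_zero i j hij f)).trans (homMk_zero s)
    | add f g hf hg => rw [hf, hg, add_zero]

theorem nonempty_decomposition {I : Type} {x : I → C} (hd : ∀ X, Nonempty (Decomposition x X))
    (X : ScalarExtension R S C) :
    Nonempty (Decomposition (fun i => (incl R S C).obj (x i)) X) :=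
  ⟨(hd X.obj).some.map (incl R S C)⟩

instance [HasFiniteBiproducts C] : HasFiniteBiproducts (ScalarExtension R S C) where
  out n := ⟨fun f => by
    exact ⟨⟨(incl R S C).mapBicone (biproduct.bicone fun j => (f j).obj),
      isBilimitOfPreserves (incl R S C) (biproduct.isBilimit _)⟩⟩⟩

/-! ### Extending semilinear functors to the extension of scalars -/

section Extend

variable {T : Type*} [CommRing T] {E : Type u₁} [Category.{v₁} E] [Preadditive E] [Linear T E]
  (ψ : S →+* T) (H : C ⥤ E) [H.Additive]
  (hH : ∀ {X Y : C} (r : R) (f : X ⟶ Y), H.map (r • f) = ψ (algebraMap R S r) • H.map f)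

/-- The map on morphisms of `ScalarExtension.extend`. -/
noncomputable def extendMap (X Y : ScalarExtension R S C) :
    (X ⟶ Y) →+ (H.obj X.obj ⟶ H.obj Y.obj) :=
  TensorProduct.liftAddHom
    { toFun := fun s =>
        { toFun := fun f => ψ s • H.map f
          map_zero' := by simp
          map_add' := fun f g => by rw [H.map_add, smul_add] }
      map_zero' := by ext; simp
      map_add' := fun s t => by ext; simp [add_smul] }
    fun r s f => by
      change ψ (r • s) • H.map f = ψ s • H.map (r • f)
      rw [hH, Algebra.smul_def, map_mul, mul_comm, mul_smul]

theorem extendMap_homMk {X Y : ScalarExtension R S C} (s : S) (f : X.obj ⟶ Y.obj) :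
    extendMap ψ H hH X Y (homMk s f) = ψ s • H.map f := rfl

/-- The extension of a semilinear functor to the extension of scalars. -/
noncomputable def extend : ScalarExtension R S C ⥤ E where
  obj X := H.obj X.obj
  map {X Y} f := extendMap ψ H hH X Y f
  map_id X := by rw [id_eq, extendMap_homMk, map_one, one_smul, H.map_id]
  map_comp {X Y Z} f g := by
    induction f using hom_induction with
    | zero => simp
    | add f f' hf hf' => simp [hf, hf']
    | mk s f =>
    induction g using hom_induction with
    | zero => simp
    | add g g' hg hg' => simp [hg, hg']
    | mk t g =>
      simp only [homMk_comp, extendMap_homMk, H.map_comp, Linear.smul_comp, Linear.comp_smul,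
        smul_smul, map_mul, mul_comm]

theorem extend_map_homMk {X Y : ScalarExtension R S C} (s : S) (f : X.obj ⟶ Y.obj) :
    (extend ψ H hH).map (homMk s f : X ⟶ Y) = ψ s • H.map f := rfl

theorem extend_map_homMk_one {X Y : ScalarExtension R S C} (f : X.obj ⟶ Y.obj) :
    (extend ψ H hH).map (homMk 1 f : X ⟶ Y) = H.map f := by
  rw [extend_map_homMk, map_one, one_smul]

instance : (extend ψ H hH).Additive where
  map_add {X Y f g} := map_add (extendMap ψ H hH X Y) f g

theorem extend_map_smul {X Y : ScalarExtension R S C} (s : S) (f : X ⟶ Y) :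
    (extend ψ H hH).map (s • f) = ψ s • (extend ψ H hH).map f := by
  induction f using hom_induction with
  | zero => simp
  | add f f' hf hf' => simp only [smul_add, Functor.map_add, hf, hf']
  | mk t f => rw [smul_homMk, extend_map_homMk, extend_map_homMk, map_mul, mul_smul]; rfl

end Extend

end Linear

/-! ### Monoidal functors and duals for extensions of scalars -/

section Monoidal

variable {R : Type*} [CommRing R] {S : Type w} [CommRing S] [Algebra R S]
variable {C : Type u} [Category.{v} C] [Preadditive C] [Linear R C]
variable [MonoidalCategory C] [MonoidalPreadditive C] [MonoidalLinear R C]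

noncomputable instance : (incl R S C).Monoidal :=
  Functor.CoreMonoidal.toMonoidal
    { εIso := Iso.refl _
      μIso := fun X Y => Iso.refl _
      μIso_hom_natural_left := fun f X' =>
        (Category.comp_id _).trans (Category.id_comp _).symm
      μIso_hom_natural_right := fun f X' =>
        (Category.comp_id _).trans (Category.id_comp _).symm
      associativity := fun X Y Z => by
        let F := (incl R S C).obj
        -- With identities as tensor constraints, the coherence axiom is definitionally this
        -- identity between morphisms of the extension.
        have : 𝟙 (F X ⊗ F Y) ▷ F Z ≫ 𝟙 ((F X ⊗ F Y) ⊗ F Z) ≫ (α_ (F X) (F Y) (F Z)).hom =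
            (α_ (F X) (F Y) (F Z)).hom ≫ F X ◁ 𝟙 (F Y ⊗ F Z) ≫ 𝟙 (F X ⊗ (F Y ⊗ F Z)) := by
          simp
        exact this
      left_unitality := fun X => by
        let F := (incl R S C).obj
        have : (λ_ (F X)).hom = 𝟙 (F (𝟙_ C)) ▷ F X ≫ 𝟙 (F (𝟙_ C) ⊗ F X) ≫ (λ_ (F X)).hom := by
          rw [id_whiskerRight, Category.id_comp]; exact (Category.id_comp _).symm
        exact this
      right_unitality := fun X => by
        let F := (incl R S C).obj
        have : (ρ_ (F X)).hom = F X ◁ 𝟙 (F (𝟙_ C)) ≫ 𝟙 (F X ⊗ F (𝟙_ C)) ≫ (ρ_ (F X)).hom := by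
          rw [whiskerLeft_id, Category.id_comp]; exact (Category.id_comp _).symm
        exact this }

variable {T : Type*} [CommRing T] {E : Type u₁} [Category.{v₁} E] [Preadditive E] [Linear T E]
  [MonoidalCategory E] [MonoidalPreadditive E] [MonoidalLinear T E]
  (ψ : S →+* T) (H : C ⥤ E) [H.Additive] [H.Monoidal]
  (hH : ∀ {X Y : C} (r : R) (f : X ⟶ Y), H.map (r • f) = ψ (algebraMap R S r) • H.map f)

theorem extend_μ_natural_left {X Y : ScalarExtension R S C} (f : X ⟶ Y)
    (X' : ScalarExtension R S C) :
    extendMap ψ H hH X Y f ▷ H.obj X'.obj ≫ Functor.LaxMonoidal.μ H Y.obj X'.obj =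
      Functor.LaxMonoidal.μ H X.obj X'.obj ≫ extendMap ψ H hH (X ⊗ X') (Y ⊗ X') (f ▷ X') := by
  induction f using hom_induction with
  | zero => simp
  | add f f' hf hf' => simp only [map_add, MonoidalPreadditive.add_whiskerRight,
      Preadditive.add_comp, hf, hf', Preadditive.comp_add]
  | mk s f =>
    rw [homMk_whiskerRight, extendMap_homMk, extendMap_homMk, MonoidalLinear.smul_whiskerRight,
      Linear.smul_comp, Functor.LaxMonoidal.μ_natural_left]
    exact (Linear.comp_smul _ _ _ _ _ _).symm

theorem extend_μ_natural_right {X Y : ScalarExtension R S C} (X' : ScalarExtension R S C)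
    (f : X ⟶ Y) :
    H.obj X'.obj ◁ extendMap ψ H hH X Y f ≫ Functor.LaxMonoidal.μ H X'.obj Y.obj =
      Functor.LaxMonoidal.μ H X'.obj X.obj ≫ extendMap ψ H hH (X' ⊗ X) (X' ⊗ Y) (X' ◁ f) := by
  induction f using hom_induction with
  | zero => simp
  | add f f' hf hf' => simp only [map_add, MonoidalPreadditive.whiskerLeft_add,
      Preadditive.add_comp, hf, hf', Preadditive.comp_add]
  | mk s f =>
    rw [whiskerLeft_homMk, extendMap_homMk, extendMap_homMk, MonoidalLinear.whiskerLeft_smul,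
      Linear.smul_comp, Functor.LaxMonoidal.μ_natural_right]
    exact (Linear.comp_smul _ _ _ _ _ _).symm

/-- On objects the extended functor is `H`, so the constraints of `H` can be reused. The coherence
isomorphisms of the extension have coefficient `1`, which reduces the axioms to those of `H`. -/
noncomputable instance : (extend ψ H hH).Monoidal :=
  Functor.CoreMonoidal.toMonoidal
    { εIso := Functor.Monoidal.εIso H
      μIso := fun X Y => Functor.Monoidal.μIso H X.obj Y.obj
      μIso_hom_natural_left := fun f X' => extend_μ_natural_left ψ H hH f X'
      μIso_hom_natural_right := fun X' f => extend_μ_natural_right ψ H hH X' f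
      associativity := fun X Y Z => by
        rw [associator_def, extend_map_homMk_one]
        exact Functor.LaxMonoidal.associativity H X.obj Y.obj Z.obj
      left_unitality := fun X => by
        rw [leftUnitor_def, extend_map_homMk_one]
        exact Functor.LaxMonoidal.left_unitality H X.obj
      right_unitality := fun X => by
        rw [rightUnitor_def, extend_map_homMk_one]
        exact Functor.LaxMonoidal.right_unitality H X.obj }

theorem associator_inv_def (X Y Z : ScalarExtension R S C) : (α_ X Y Z).inv =
    homMk (X := X ⊗ Y ⊗ Z) (Y := (X ⊗ Y) ⊗ Z) 1 (α_ X.obj Y.obj Z.obj).inv := rfl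

theorem leftUnitor_inv_def (X : ScalarExtension R S C) : (λ_ X).inv =
    homMk (X := X) (Y := 𝟙_ _ ⊗ X) 1 (λ_ X.obj).inv := rfl

theorem rightUnitor_inv_def (X : ScalarExtension R S C) : (ρ_ X).inv =
    homMk (X := X) (Y := X ⊗ 𝟙_ _) 1 (ρ_ X.obj).inv := rfl

/-- The image of an exact pairing in the extension of scalars. -/
@[reducible]
noncomputable def exactPairing (X Y : ScalarExtension R S C) [ExactPairing X.obj Y.obj] :
    ExactPairing X Y where
  coevaluation' := homMk (X := 𝟙_ _) (Y := X ⊗ Y) 1 (η_ X.obj Y.obj)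
  evaluation' := homMk (X := Y ⊗ X) (Y := 𝟙_ _) 1 (ε_ X.obj Y.obj)
  coevaluation_evaluation' := by
    rw [associator_inv_def, rightUnitor_def, leftUnitor_inv_def, homMk_whiskerRight,
      whiskerLeft_homMk, homMk_comp, homMk_comp, homMk_comp, one_mul, one_mul]
    exact congrArg (homMk _) (ExactPairing.coevaluation_evaluation X.obj Y.obj)
  evaluation_coevaluation' := by
    rw [associator_def, leftUnitor_def, rightUnitor_inv_def, homMk_whiskerRight,
      whiskerLeft_homMk, homMk_comp, homMk_comp, homMk_comp, one_mul, one_mul]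
    exact congrArg (homMk _) (ExactPairing.evaluation_coevaluation X.obj Y.obj)

noncomputable instance [RigidCategory C] : RigidCategory (ScalarExtension R S C) where
  rightDual X := { rightDual := ⟨X.objᘁ⟩, exact := exactPairing X ⟨X.objᘁ⟩ }
  leftDual X := { leftDual := ⟨ᘁX.obj⟩, exact := exactPairing ⟨ᘁX.obj⟩ X }

end Monoidal

end ScalarExtension

/-! ### Decompositions in monoidal categories and integral morphisms -/

section

variable {E : Type u} [Category.{v} E] [Preadditive E] [MonoidalCategory E]
  [MonoidalPreadditive E]

theorem Decomposition.sum_tensorHom_eq_id {I : Type} {x : I → E} {X Y : E}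
    (d : Decomposition x X) (e : Decomposition x Y) :
    ∑ j, ∑ k, ((d.proj j ≫ d.incl j) ⊗ₘ (e.proj k ≫ e.incl k)) = 𝟙 (X ⊗ Y) := by
  simp only [← tensor_sum, e.total]
  rw [← sum_tensor, d.total, id_tensorHom_id]

/-- The decomposition of a tensor product of decomposed objects. -/
def Decomposition.tensor {I : Type} {x : I → E} (t : ∀ i j, Decomposition x (x i ⊗ x j))
    {X Y : E} (d : Decomposition x X) (e : Decomposition x Y) : Decomposition x (X ⊗ Y) where
  J := Σ p : d.J × e.J, (t (d.index p.1) (e.index p.2)).J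
  index q := (t (d.index q.1.1) (e.index q.1.2)).index q.2
  incl q := (t (d.index q.1.1) (e.index q.1.2)).incl q.2 ≫ (d.incl q.1.1 ⊗ₘ e.incl q.1.2)
  proj q := (d.proj q.1.1 ⊗ₘ e.proj q.1.2) ≫ (t (d.index q.1.1) (e.index q.1.2)).proj q.2
  incl_proj q := by
    simp [tensorHom_comp_tensorHom_assoc]
  incl_proj_ne := by
    rintro ⟨⟨j, k⟩, l⟩ ⟨⟨j', k'⟩, l'⟩ h
    by_cases hj : j = j'
    · subst hj
      by_cases hk : k = k'
      · subst hk
        have : l ≠ l' := fun h' => h (by rw [h'])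
        simp [tensorHom_comp_tensorHom_assoc, (t (d.index j) (e.index k)).incl_proj_ne _ _ this]
      · simp [tensorHom_comp_tensorHom_assoc, e.incl_proj_ne _ _ hk]
    · simp [tensorHom_comp_tensorHom_assoc, d.incl_proj_ne _ _ hj]
  total := by
    rw [Fintype.sum_sigma, Fintype.sum_prod_type]
    have : ∀ j k, ∑ l, ((d.proj j ⊗ₘ e.proj k) ≫ (t (d.index j) (e.index k)).proj l) ≫
        (t (d.index j) (e.index k)).incl l ≫ (d.incl j ⊗ₘ e.incl k) =
          (d.proj j ≫ d.incl j) ⊗ₘ (e.proj k ≫ e.incl k) := by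
      intro j k
      have h := (t (d.index j) (e.index k)).total
      have : ∀ l, ((d.proj j ⊗ₘ e.proj k) ≫ (t (d.index j) (e.index k)).proj l) ≫
        (t (d.index j) (e.index k)).incl l ≫ (d.incl j ⊗ₘ e.incl k) = (d.proj j ⊗ₘ e.proj k) ≫
          ((t (d.index j) (e.index k)).proj l ≫ (t (d.index j) (e.index k)).incl l) ≫
            (d.incl j ⊗ₘ e.incl k) := by simp
      simp only [this]
      rw [← Preadditive.comp_sum, ← Preadditive.sum_comp, h, Category.id_comp,
        tensorHom_comp_tensorHom]
    simp only [this]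
    exact d.sum_tensorHom_eq_id e

/-- The exact pairing between two direct sums whose summands are paired. -/
@[reducible]
def CategoryTheory.ExactPairing.ofSum {J : Type} [Fintype J] {x y : J → E} {X Y : E}
    (i : ∀ j, x j ⟶ X) (p : ∀ j, X ⟶ x j) (i' : ∀ j, y j ⟶ Y) (p' : ∀ j, Y ⟶ y j)
    (h : ∀ j, i j ≫ p j = 𝟙 _) (h_ne : ∀ j k, j ≠ k → i j ≫ p k = 0)
    (h_total : ∑ j, p j ≫ i j = 𝟙 X)
    (h' : ∀ j, i' j ≫ p' j = 𝟙 _) (h_ne' : ∀ j k, j ≠ k → i' j ≫ p' k = 0)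
    (h_total' : ∑ j, p' j ≫ i' j = 𝟙 Y) [∀ j, ExactPairing (x j) (y j)] :
    ExactPairing X Y where
  coevaluation' := ∑ j, η_ (x j) (y j) ≫ (i j ⊗ₘ i' j)
  evaluation' := ∑ j, (p' j ⊗ₘ p j) ≫ ε_ (x j) (y j)
  coevaluation_evaluation' := by
    -- Moving inclusions and projections together across the associator isolates the factor `i j ≫ p
    -- k`, which kills the off-diagonal terms of the double sum.
    have key : ∀ j k, Y ◁ (η_ (x j) (y j) ≫ (i j ⊗ₘ i' j)) ≫ (α_ _ _ _).inv ≫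
        ((p' k ⊗ₘ p k) ≫ ε_ (x k) (y k)) ▷ Y = Y ◁ η_ (x j) (y j) ≫ (α_ _ _ _).inv ≫
          ((p' k ⊗ₘ (i j ≫ p k)) ⊗ₘ i' j) ≫ ε_ (x k) (y k) ▷ Y := by
      intro j k
      have : Y ◁ (i j ⊗ₘ i' j) ≫ (α_ _ _ _).inv ≫ (p' k ⊗ₘ p k) ▷ Y =
          (α_ _ _ _).inv ≫ ((p' k ⊗ₘ (i j ≫ p k)) ⊗ₘ i' j) := by
        rw [← id_tensorHom, ← tensorHom_id, associator_inv_naturality_assoc,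
          tensorHom_comp_tensorHom, tensorHom_comp_tensorHom, Category.id_comp, Category.comp_id]
      rw [whiskerLeft_comp, comp_whiskerRight, Category.assoc, reassoc_of% this]
    -- On the diagonal the zigzag identity of the pair `x j`, `y j` leaves the projector of `Y` onto
    -- `y j`; these projectors add up to `𝟙 Y`.
    have key_self : ∀ j, Y ◁ η_ (x j) (y j) ≫ (α_ _ _ _).inv ≫
          ((p' j ⊗ₘ (i j ≫ p j)) ⊗ₘ i' j) ≫ ε_ (x j) (y j) ▷ Y =
        (ρ_ Y).hom ≫ (p' j ≫ i' j) ≫ (λ_ Y).inv := by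
      intro j
      rw [h j, tensorHom_id, MonoidalCategory.tensorHom_def, Category.assoc, whisker_exchange,
        ← associator_inv_naturality_left_assoc, whisker_exchange_assoc,
        ExactPairing.coevaluation_evaluation_assoc, rightUnitor_naturality_assoc,
        Category.assoc, leftUnitor_inv_naturality]
    simp only [Preadditive.sum_comp, Preadditive.comp_sum, whiskerLeft_sum, sum_whiskerRight, key]
    rw [Finset.sum_congr rfl fun j _ => Finset.sum_eq_single j
      (fun k _ hk => by simp [h_ne _ _ hk]) (by simp)]
    simp only [key_self]
    rw [← Preadditive.comp_sum, ← Preadditive.sum_comp, h_total', Category.id_comp]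
  evaluation_coevaluation' := by
    have key : ∀ j k, (η_ (x j) (y j) ≫ (i j ⊗ₘ i' j)) ▷ X ≫ (α_ _ _ _).hom ≫
        X ◁ ((p' k ⊗ₘ p k) ≫ ε_ (x k) (y k)) = η_ (x j) (y j) ▷ X ≫ (α_ _ _ _).hom ≫
          (i j ⊗ₘ ((i' j ≫ p' k) ⊗ₘ p k)) ≫ X ◁ ε_ (x k) (y k) := by
      intro j k
      have : (i j ⊗ₘ i' j) ▷ X ≫ (α_ _ _ _).hom ≫ X ◁ (p' k ⊗ₘ p k) =
          (α_ _ _ _).hom ≫ (i j ⊗ₘ ((i' j ≫ p' k) ⊗ₘ p k)) := by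
        rw [← id_tensorHom, ← tensorHom_id, associator_naturality_assoc,
          tensorHom_comp_tensorHom, tensorHom_comp_tensorHom, Category.id_comp, Category.comp_id]
      rw [whiskerLeft_comp, comp_whiskerRight, Category.assoc, reassoc_of% this]
    have key_self : ∀ j, η_ (x j) (y j) ▷ X ≫ (α_ _ _ _).hom ≫
          (i j ⊗ₘ ((i' j ≫ p' j) ⊗ₘ p j)) ≫ X ◁ ε_ (x j) (y j) =
        (λ_ X).hom ≫ (p j ≫ i j) ≫ (ρ_ X).inv := by
      intro j
      rw [h' j, id_tensorHom, tensorHom_def', Category.assoc, ← whisker_exchange,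
        ← associator_naturality_right_assoc, ← whisker_exchange_assoc,
        ExactPairing.evaluation_coevaluation_assoc, leftUnitor_naturality_assoc,
        Category.assoc, rightUnitor_inv_naturality]
    simp only [Preadditive.sum_comp, Preadditive.comp_sum, whiskerLeft_sum, sum_whiskerRight, key]
    rw [Finset.sum_congr rfl fun j _ => Finset.sum_eq_single j
      (fun k _ hk => by simp [h_ne' _ _ hk]) (by simp)]
    simp only [key_self]
    rw [← Preadditive.comp_sum, ← Preadditive.sum_comp, h_total, Category.id_comp]

end

/-! ### Morphisms with integral matrices -/

section

variable {R : Type*} [CommRing R] {E : Type u} [Category.{v} E] [Preadditive E] [Linear R E]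
  {I : Type} {x : I → E}

/-- A morphism between decomposed objects is integral over a subring if its matrix is. -/
def IsIntegralHom (hx : SchurFamily R x) (A : Subring R) {X Y : E} (d : Decomposition x X)
    (e : Decomposition x Y) (f : X ⟶ Y) : Prop :=
  ∀ j k, d.mat hx e f j k ∈ A

namespace IsIntegralHom

variable {hx : SchurFamily R x} {A : Subring R} {X Y Z : E} {d : Decomposition x X}
    {e : Decomposition x Y} {c : Decomposition x Z}

theorem zero : IsIntegralHom hx A d e 0 := fun j k => by simp [zero_mem]

theorem add {f g : X ⟶ Y} (hf : IsIntegralHom hx A d e f) (hg : IsIntegralHom hx A d e g) :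
    IsIntegralHom hx A d e (f + g) := fun j k => by
  rw [map_add]; exact add_mem (hf j k) (hg j k)

theorem sum {ι : Type*} {s : Finset ι} {f : ι → (X ⟶ Y)}
    (hf : ∀ i ∈ s, IsIntegralHom hx A d e (f i)) :
    IsIntegralHom hx A d e (∑ i ∈ s, f i) :=
  Finset.sum_induction f _ (fun _ _ => add) zero hf

theorem smul {f : X ⟶ Y} (hf : IsIntegralHom hx A d e f) {r : R} (hr : r ∈ A) :
    IsIntegralHom hx A d e (r • f) := fun j k => by
  rw [map_smul]; exact mul_mem hr (hf j k)

theorem comp {f : X ⟶ Y} {g : Y ⟶ Z} (hf : IsIntegralHom hx A d e f)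
    (hg : IsIntegralHom hx A e c g) : IsIntegralHom hx A d c (f ≫ g) := fun j k => by
  rw [d.mat_comp hx e, Matrix.mul_apply]
  exact sum_mem fun l _ => mul_mem (hf j l) (hg l k)

/-- These coefficients are `0` or `1`, so inclusions and projections of a decomposition are integral
over every subring. -/
theorem coef_incl_proj_mem (d : Decomposition x X) (j k : d.J) :
    hx.coef _ _ (d.incl j ≫ d.proj k) ∈ A := by
  rcases eq_or_ne j k with rfl | h
  · simp [one_mem]
  · simp [d.incl_proj_ne _ _ h, zero_mem]

theorem incl (d : Decomposition x X) (j : d.J) :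
    IsIntegralHom hx A (.single x (d.index j)) d (d.incl j) := fun _ k => by
  have := coef_incl_proj_mem (hx := hx) (A := A) d j k
  rwa [← Category.id_comp (d.incl j), Category.assoc] at this

theorem proj (d : Decomposition x X) (j : d.J) :
    IsIntegralHom hx A d (.single x (d.index j)) (d.proj j) := fun k _ => by
  have := coef_incl_proj_mem (hx := hx) (A := A) d k j
  rwa [← Category.comp_id (d.proj j)] at this

theorem id (d : Decomposition x X) : IsIntegralHom hx A d d (𝟙 X) := by
  rw [← d.total]
  exact sum fun j _ => (proj d j).comp (incl d j)

theorem ι_sum [HasFiniteBiproducts E] {n : ℕ} {X : Fin n → E} (d : ∀ m, Decomposition x (X m))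
    (m : Fin n) : IsIntegralHom hx A (d m) (.sum d) (biproduct.ι X m) := by
  rw [← Category.id_comp (biproduct.ι X m), ← (d m).total, Preadditive.sum_comp]
  refine sum fun j _ => ?_
  rw [Category.assoc]
  exact (proj (d m) j).comp (incl (.sum d) ⟨m, j⟩)

theorem π_sum [HasFiniteBiproducts E] {n : ℕ} {X : Fin n → E} (d : ∀ m, Decomposition x (X m))
    (m : Fin n) : IsIntegralHom hx A (.sum d) (d m) (biproduct.π X m) := by
  rw [← Category.comp_id (biproduct.π X m), ← (d m).total, Preadditive.comp_sum]
  refine sum fun j _ => ?_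
  rw [← Category.assoc]
  exact (proj (.sum d) ⟨m, j⟩).comp (incl (d m) j)

variable [MonoidalCategory E] [MonoidalPreadditive E] [MonoidalLinear R E]
  {t : ∀ i j, Decomposition x (x i ⊗ x j)}
  {X' Y' Z' : E} {d' : Decomposition x X'} {e' : Decomposition x Y'} {c' : Decomposition x Z'}

/-- Each block of the matrix comes from a pair of morphisms between members. It vanishes unless both
are scalars, and then it is the product of two elements of `A` with a matrix of zeros and ones. The
zeros and ones appear because source and target use the same chosen decompositions `t`. -/
theorem tensorHom {f : X ⟶ Y} {g : X' ⟶ Y'} (hf : IsIntegralHom hx A d e f)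
    (hg : IsIntegralHom hx A d' e' g) :
    IsIntegralHom hx A (.tensor t d d') (.tensor t e e') (f ⊗ₘ g) := by
  have key : ∀ (i j k l : I) (a : x i ⟶ x j) (b : x k ⟶ x l), hx.coef _ _ a ∈ A →
      hx.coef _ _ b ∈ A → ∀ p q, hx.coef _ _ ((t i k).incl p ≫ (a ⊗ₘ b) ≫ (t j l).proj q) ∈ A := by
    intro i j k l a b ha hb p q
    by_cases hij : i = j
    · subst hij
      by_cases hkl : k = l
      · subst hkl
        rw [← hx.coef_smul_id_self i a, ← hx.coef_smul_id_self k b]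
        simp only [MonoidalCategory.tensorHom_def, MonoidalLinear.smul_whiskerRight,
          MonoidalLinear.whiskerLeft_smul, whiskerLeft_id, id_whiskerRight,
          Linear.smul_comp, Linear.comp_smul, Category.id_comp, map_smul, smul_eq_mul]
        exact mul_mem hb (mul_mem ha (coef_incl_proj_mem _ _ _))
      · rw [hx.hom_eq_zero k l hkl b]; simp [zero_mem]
    · rw [hx.hom_eq_zero i j hij a]; simp [zero_mem]
  rintro ⟨⟨j, j'⟩, p⟩ ⟨⟨k, k'⟩, q⟩
  have := key _ _ _ _ _ _ (hf j k) (hg j' k') p q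
  rw [← tensorHom_comp_tensorHom, ← tensorHom_comp_tensorHom, Category.assoc, Category.assoc,
    ← Category.assoc] at this
  exact this

theorem whiskerLeft {g : X' ⟶ Y'} (d : Decomposition x X) (hg : IsIntegralHom hx A d' e' g) :
    IsIntegralHom hx A (.tensor t d d') (.tensor t d e') (X ◁ g) := by
  rw [← id_tensorHom]
  exact (IsIntegralHom.id d).tensorHom hg

theorem whiskerRight {g : X' ⟶ Y'} (hg : IsIntegralHom hx A d' e' g) (d : Decomposition x X) :
    IsIntegralHom hx A (.tensor t d' d) (.tensor t e' d) (g ▷ X) := by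
  rw [← tensorHom_id]
  exact hg.tensorHom (IsIntegralHom.id d)

/-- Associators are integral if those of the members of the family are. -/
theorem associator_hom (h : ∀ i j k, IsIntegralHom hx A
      (.tensor t (.tensor t (.single x i) (.single x j)) (.single x k))
      (.tensor t (.single x i) (.tensor t (.single x j) (.single x k))) (α_ (x i) (x j) (x k)).hom)
    (d : Decomposition x X) (e : Decomposition x Y) (c : Decomposition x Z) :
    IsIntegralHom hx A (.tensor t (.tensor t d e) c) (.tensor t d (.tensor t e c))
      (α_ X Y Z).hom := by
  -- By naturality the associator is the sum of the associators of the summands, framed by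
  -- projections and inclusions, which are integral.
  have : (α_ X Y Z).hom = ∑ j, ∑ k, ∑ l, ((d.proj j ⊗ₘ e.proj k) ⊗ₘ c.proj l) ≫
      (α_ _ _ _).hom ≫ (d.incl j ⊗ₘ (e.incl k ⊗ₘ c.incl l)) := by
    simp only [← associator_naturality, tensorHom_comp_tensorHom_assoc]
    simp only [← Preadditive.sum_comp, ← tensor_sum, c.total]
    simp only [← sum_tensor]
    simp only [tensorHom_comp_tensorHom, d.sum_tensorHom_eq_id e]
    simp
  rw [this]
  exact sum fun j _ => sum fun k _ => sum fun l _ =>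
    (((proj d j).tensorHom (proj e k)).tensorHom (proj c l)).comp
      ((h _ _ _).comp ((incl d j).tensorHom ((incl e k).tensorHom (incl c l))))

theorem associator_inv (h : ∀ i j k, IsIntegralHom hx A
      (.tensor t (.single x i) (.tensor t (.single x j) (.single x k)))
      (.tensor t (.tensor t (.single x i) (.single x j)) (.single x k)) (α_ (x i) (x j) (x k)).inv)
    (d : Decomposition x X) (e : Decomposition x Y) (c : Decomposition x Z) :
    IsIntegralHom hx A (.tensor t d (.tensor t e c)) (.tensor t (.tensor t d e) c)
      (α_ X Y Z).inv := by
  have : (α_ X Y Z).inv = ∑ j, ∑ k, ∑ l, (d.proj j ⊗ₘ (e.proj k ⊗ₘ c.proj l)) ≫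
      (α_ _ _ _).inv ≫ ((d.incl j ⊗ₘ e.incl k) ⊗ₘ c.incl l) := by
    simp only [← associator_inv_naturality, tensorHom_comp_tensorHom_assoc]
    simp only [← Preadditive.sum_comp, ← tensor_sum]
    simp only [tensorHom_comp_tensorHom, e.sum_tensorHom_eq_id c]
    simp only [← sum_tensor, d.total]
    simp
  rw [this]
  exact sum fun j _ => sum fun k _ => sum fun l _ =>
    ((proj d j).tensorHom ((proj e k).tensorHom (proj c l))).comp
      ((h _ _ _).comp (((incl d j).tensorHom (incl e k)).tensorHom (incl c l)))

variable {o : Decomposition x (𝟙_ E)}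

/-- Naturality reduces the unitor to the unitors of the summands. The same argument serves for the
inverse and for the right unitor. -/
theorem leftUnitor_hom
    (h : ∀ i, IsIntegralHom hx A (.tensor t o (.single x i)) (.single x i) (λ_ (x i)).hom)
    (d : Decomposition x X) : IsIntegralHom hx A (.tensor t o d) d (λ_ X).hom := by
  have : (λ_ X).hom = ∑ j, (𝟙_ E ◁ d.proj j) ≫ (λ_ _).hom ≫ d.incl j := by
    simp only [leftUnitor_naturality_assoc, ← Preadditive.comp_sum, d.total, Category.comp_id]
  rw [this]
  exact sum fun j _ => ((proj d j).whiskerLeft o).comp ((h _).comp (incl d j))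

theorem leftUnitor_inv
    (h : ∀ i, IsIntegralHom hx A (.single x i) (.tensor t o (.single x i)) (λ_ (x i)).inv)
    (d : Decomposition x X) : IsIntegralHom hx A d (.tensor t o d) (λ_ X).inv := by
  have : (λ_ X).inv = ∑ j, d.proj j ≫ (λ_ _).inv ≫ (𝟙_ E ◁ d.incl j) := by
    simp only [← leftUnitor_inv_naturality, ← Category.assoc, ← Preadditive.sum_comp, d.total,
      Category.id_comp]
  rw [this]
  exact sum fun j _ => (proj d j).comp ((h _).comp ((incl d j).whiskerLeft o))

theorem rightUnitor_hom
    (h : ∀ i, IsIntegralHom hx A (.tensor t (.single x i) o) (.single x i) (ρ_ (x i)).hom)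
    (d : Decomposition x X) : IsIntegralHom hx A (.tensor t d o) d (ρ_ X).hom := by
  have : (ρ_ X).hom = ∑ j, (d.proj j ▷ 𝟙_ E) ≫ (ρ_ _).hom ≫ d.incl j := by
    simp only [rightUnitor_naturality_assoc, ← Preadditive.comp_sum, d.total, Category.comp_id]
  rw [this]
  exact sum fun j _ => ((proj d j).whiskerRight o).comp ((h _).comp (incl d j))

theorem rightUnitor_inv
    (h : ∀ i, IsIntegralHom hx A (.single x i) (.tensor t (.single x i) o) (ρ_ (x i)).inv)
    (d : Decomposition x X) : IsIntegralHom hx A d (.tensor t d o) (ρ_ X).inv := by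
  have : (ρ_ X).inv = ∑ j, d.proj j ≫ (ρ_ _).inv ≫ (d.incl j ▷ 𝟙_ E) := by
    simp only [← rightUnitor_inv_naturality, ← Category.assoc, ← Preadditive.sum_comp, d.total,
      Category.id_comp]
  rw [this]
  exact sum fun j _ => (proj d j).comp ((h _).comp ((incl d j).whiskerRight o))

end IsIntegralHom

/-- The entries of the matrix of a morphism form a finite set. -/
theorem exists_finite_isIntegralHom (hx : SchurFamily R x) {X Y : E} (d : Decomposition x X)
    (e : Decomposition x Y) (f : X ⟶ Y) :
    ∃ T : Set R, T.Finite ∧ ∀ A : Subring R, T ⊆ A → IsIntegralHom hx A d e f :=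
  ⟨Set.range fun p : d.J × e.J => d.mat hx e f p.1 p.2, Set.finite_range _,
    fun _ hA j k => hA ⟨(j, k), rfl⟩⟩

end

/-! ### Integral forms of fusion categories -/

/-- A finite Schur family in a monoidal category by which all objects decompose. -/
structure FusionBasis (K : Type*) [Field K] (C : Type u) [Category.{v} C] [Preadditive C]
    [Linear K C] where
  /-- the index set -/
  I : Type
  [finite : Finite I]
  /-- the members of the family -/
  obj : I → C
  schur : SchurFamily K obj
  /-- a decomposition of each object -/
  decomposition : ∀ X, Decomposition obj X

attribute [instance] FusionBasis.finite

/-- Formal expressions in the members of a family, tensor products and finite direct sums. -/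
inductive FusionWord (I : Type) : Type
  | simple (i : I)
  | unit
  | tensor (X Y : FusionWord I)
  | sum (n : ℕ) (X : Fin n → FusionWord I)

namespace FusionBasis

variable {K : Type*} [Field K] {C : Type u} [Category.{v} C] [Preadditive C] [Linear K C]
  [HasFiniteBiproducts C] [MonoidalCategory C]
  (B : FusionBasis K C)

/-- The object described by a word. -/
noncomputable def eval : FusionWord B.I → C
  | .simple i => B.obj i
  | .unit => 𝟙_ C
  | .tensor X Y => eval X ⊗ eval Y
  | .sum _ X => ⨁ fun m => eval (X m)

theorem exists_iso_eval (X : C) : ∃ Y : FusionWord B.I, Nonempty (X ≅ B.eval Y) := by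
  obtain ⟨n, a, e⟩ := (B.decomposition X).exists_fin_biproduct
  exact ⟨.sum n fun m => .simple (a m), e⟩

/-- The chosen decompositions of the tensor products of members of the family. -/
abbrev tensorDecomposition (i j : B.I) : Decomposition B.obj (B.obj i ⊗ B.obj j) :=
  B.decomposition (B.obj i ⊗ B.obj j)

variable [MonoidalPreadditive C]

/-- The decomposition of the object described by a word that is built from the decompositions of
the unit object and of the tensor products of members of the family. -/
noncomputable def dec : ∀ X : FusionWord B.I, Decomposition B.obj (B.eval X)
  | .simple i => .single B.obj i
  | .unit => B.decomposition (𝟙_ C)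
  | .tensor X Y => .tensor B.tensorDecomposition (dec X) (dec Y)
  | .sum _ X => .sum fun m => dec (X m)

/-- Integrality of a morphism between objects described by words. -/
abbrev IsIntegral (A : Subring K) {X Y : FusionWord B.I} (f : B.eval X ⟶ B.eval Y) : Prop :=
  IsIntegralHom B.schur A (B.dec X) (B.dec Y) f

/-- The structure constants of the monoidal category lie in the subring `A`. -/
class IsDefinedOver (A : Subring K) : Prop where
  associator_hom : ∀ i j k : B.I, B.IsIntegral A
    (X := .tensor (.tensor (.simple i) (.simple j)) (.simple k))
    (Y := .tensor (.simple i) (.tensor (.simple j) (.simple k)))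
    (α_ (B.obj i) (B.obj j) (B.obj k)).hom
  associator_inv : ∀ i j k : B.I, B.IsIntegral A
    (X := .tensor (.simple i) (.tensor (.simple j) (.simple k)))
    (Y := .tensor (.tensor (.simple i) (.simple j)) (.simple k))
    (α_ (B.obj i) (B.obj j) (B.obj k)).inv
  leftUnitor_hom : ∀ i : B.I, B.IsIntegral A (X := .tensor .unit (.simple i)) (Y := .simple i)
    (λ_ (B.obj i)).hom
  leftUnitor_inv : ∀ i : B.I, B.IsIntegral A (X := .simple i) (Y := .tensor .unit (.simple i))
    (λ_ (B.obj i)).inv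
  rightUnitor_hom : ∀ i : B.I, B.IsIntegral A (X := .tensor (.simple i) .unit) (Y := .simple i)
    (ρ_ (B.obj i)).hom
  rightUnitor_inv : ∀ i : B.I, B.IsIntegral A (X := .simple i) (Y := .tensor (.simple i) .unit)
    (ρ_ (B.obj i)).inv
  -- Duals are needed for the members only: a general object is a direct sum of members, and its
  -- dual is the sum of their duals.
  exists_rightDual : ∀ i : B.I, ∃ (Y : FusionWord B.I) (_ : ExactPairing (B.obj i) (B.eval Y)),
    B.IsIntegral A (X := .unit) (Y := .tensor (.simple i) Y) (η_ (B.obj i) (B.eval Y)) ∧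
    B.IsIntegral A (X := .tensor Y (.simple i)) (Y := .unit) (ε_ (B.obj i) (B.eval Y))
  exists_leftDual : ∀ i : B.I, ∃ (Y : FusionWord B.I) (_ : ExactPairing (B.eval Y) (B.obj i)),
    B.IsIntegral A (X := .unit) (Y := .tensor Y (.simple i)) (η_ (B.eval Y) (B.obj i)) ∧
    B.IsIntegral A (X := .tensor (.simple i) Y) (Y := .unit) (ε_ (B.eval Y) (B.obj i))

/-- A fusion category is defined over all subrings that contain a certain finite set. -/
theorem exists_finite_isDefinedOver [RigidCategory C] :
    ∃ T : Set K, T.Finite ∧ ∀ A : Subring K, T ⊆ A → B.IsDefinedOver A := by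
  have fin : ∀ (ι : Type) [Finite ι] (P : ι → Subring K → Prop),
      (∀ i, ∃ T : Set K, T.Finite ∧ ∀ A : Subring K, T ⊆ A → P i A) →
      ∃ T : Set K, T.Finite ∧ ∀ A : Subring K, T ⊆ A → ∀ i, P i A := by
    intro ι _ P h
    choose T hT hP using h
    exact ⟨⋃ i, T i, Set.finite_iUnion hT, fun A hA i =>
      hP i A ((Set.subset_iUnion T i).trans hA)⟩
  have key (X Y : FusionWord B.I) (f : B.eval X ⟶ B.eval Y) :
      ∃ T : Set K, T.Finite ∧ ∀ A : Subring K, T ⊆ A → B.IsIntegral A f :=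
    exists_finite_isIntegralHom B.schur (B.dec X) (B.dec Y) f
  have hr (i : B.I) : ∃ T : Set K, T.Finite ∧ ∀ A : Subring K, T ⊆ A →
      ∃ (Y : FusionWord B.I) (_ : ExactPairing (B.obj i) (B.eval Y)),
        B.IsIntegral A (X := .unit) (Y := .tensor (.simple i) Y) (η_ (B.obj i) (B.eval Y)) ∧
        B.IsIntegral A (X := .tensor Y (.simple i)) (Y := .unit)
          (ε_ (B.obj i) (B.eval Y)) := by
    -- The dual given by rigidity need not be the value of a word, so the pairing is transported to
    -- an isomorphic object that is.
    obtain ⟨W, ⟨e⟩⟩ := B.exists_iso_eval (B.obj i)ᘁ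
    let p := exactPairingCongrRight (X := B.obj i) e.symm
    obtain ⟨T₁, hT₁, h₁⟩ := key .unit (.tensor (.simple i) W) (η_ (B.obj i) (B.eval W))
    obtain ⟨T₂, hT₂, h₂⟩ := key (.tensor W (.simple i)) .unit (ε_ (B.obj i) (B.eval W))
    exact ⟨T₁ ∪ T₂, hT₁.union hT₂, fun A hA => ⟨W, p, h₁ A (Set.subset_union_left.trans hA),
      h₂ A (Set.subset_union_right.trans hA)⟩⟩
  have hl (i : B.I) : ∃ T : Set K, T.Finite ∧ ∀ A : Subring K, T ⊆ A →
      ∃ (Y : FusionWord B.I) (_ : ExactPairing (B.eval Y) (B.obj i)),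
        B.IsIntegral A (X := .unit) (Y := .tensor Y (.simple i)) (η_ (B.eval Y) (B.obj i)) ∧
        B.IsIntegral A (X := .tensor (.simple i) Y) (Y := .unit)
          (ε_ (B.eval Y) (B.obj i)) := by
    obtain ⟨W, ⟨e⟩⟩ := B.exists_iso_eval (ᘁ(B.obj i))
    let p := exactPairingCongrLeft (Y := B.obj i) e.symm
    obtain ⟨T₁, hT₁, h₁⟩ := key .unit (.tensor W (.simple i)) (η_ (B.eval W) (B.obj i))
    obtain ⟨T₂, hT₂, h₂⟩ := key (.tensor (.simple i) W) .unit (ε_ (B.eval W) (B.obj i))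
    exact ⟨T₁ ∪ T₂, hT₁.union hT₂, fun A hA => ⟨W, p, h₁ A (Set.subset_union_left.trans hA),
      h₂ A (Set.subset_union_right.trans hA)⟩⟩
  obtain ⟨T₁, hT₁, h₁⟩ := fin _ _ fun i => fin _ _ fun j => fin _ _ fun k => key
    (.tensor (.tensor (.simple i) (.simple j)) (.simple k))
    (.tensor (.simple i) (.tensor (.simple j) (.simple k))) (α_ (B.obj i) (B.obj j) (B.obj k)).hom
  obtain ⟨T₂, hT₂, h₂⟩ := fin _ _ fun i => fin _ _ fun j => fin _ _ fun k => key
    (.tensor (.simple i) (.tensor (.simple j) (.simple k)))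
    (.tensor (.tensor (.simple i) (.simple j)) (.simple k)) (α_ (B.obj i) (B.obj j) (B.obj k)).inv
  obtain ⟨T₃, hT₃, h₃⟩ := fin _ _ fun i => key (.tensor .unit (.simple i)) (.simple i)
    (λ_ (B.obj i)).hom
  obtain ⟨T₄, hT₄, h₄⟩ := fin _ _ fun i => key (.simple i) (.tensor .unit (.simple i))
    (λ_ (B.obj i)).inv
  obtain ⟨T₅, hT₅, h₅⟩ := fin _ _ fun i => key (.tensor (.simple i) .unit) (.simple i)
    (ρ_ (B.obj i)).hom
  obtain ⟨T₆, hT₆, h₆⟩ := fin _ _ fun i => key (.simple i) (.tensor (.simple i) .unit)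
    (ρ_ (B.obj i)).inv
  obtain ⟨T₇, hT₇, h₇⟩ := fin _ _ hr
  obtain ⟨T₈, hT₈, h₈⟩ := fin _ _ hl
  refine ⟨T₁ ∪ T₂ ∪ T₃ ∪ T₄ ∪ T₅ ∪ T₆ ∪ T₇ ∪ T₈, by simp [*], fun A hA => ?_⟩
  simp only [Set.union_subset_iff] at hA
  obtain ⟨⟨⟨⟨⟨⟨⟨a₁, a₂⟩, a₃⟩, a₄⟩, a₅⟩, a₆⟩, a₇⟩, a₈⟩ := hA
  exact ⟨h₁ A a₁, h₂ A a₂, h₃ A a₃, h₄ A a₄, h₅ A a₅, h₆ A a₆, h₇ A a₇, h₈ A a₈⟩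

end FusionBasis

/-! ### The integral form as a linear category -/

namespace FusionBasis

variable {K : Type w} [Field K] {C : Type u} [Category.{v} C] [Preadditive C] [Linear K C]
  [HasFiniteBiproducts C] [MonoidalCategory C] [MonoidalPreadditive C]

/-- The integral form over the subring `A` of a fusion category: its objects are words, and its
morphisms are the matrices with entries in `A` that describe morphisms of the category. -/
structure IntegralForm (B : FusionBasis K C) (A : Subring K) where
  /-- the underlying word -/
  word : FusionWord B.I

/-- The matrices with entries in `A` that describe morphisms. -/
def integralMatrices (B : FusionBasis K C) (A : Subring K) (X Y : FusionWord B.I) :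
    Submodule A (Matrix (B.dec X).J (B.dec Y).J K) where
  carrier := {M | ∃ f : B.eval X ⟶ B.eval Y, B.IsIntegral A f ∧
    (B.dec X).mat B.schur (B.dec Y) f = M}
  add_mem' := by
    rintro _ _ ⟨f, hf, rfl⟩ ⟨g, hg, rfl⟩
    exact ⟨f + g, hf.add hg, map_add _ _ _⟩
  zero_mem' := ⟨0, .zero, map_zero _⟩
  smul_mem' := by
    rintro a _ ⟨f, hf, rfl⟩
    exact ⟨(a : K) • f, hf.smul a.2, map_smul _ _ _⟩

namespace IntegralForm

variable {B : FusionBasis K C} {A : Subring K}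

/-- The object described by an object of the integral form. -/
noncomputable abbrev eval (X : IntegralForm B A) : C := B.eval X.word

/-- The morphism described by an integral matrix. -/
noncomputable def toHom {X Y : FusionWord B.I} (M : B.integralMatrices A X Y) :
    B.eval X ⟶ B.eval Y := M.2.choose

theorem isIntegral_toHom {X Y : FusionWord B.I} (M : B.integralMatrices A X Y) :
    B.IsIntegral A (toHom M) := M.2.choose_spec.1

theorem mat_toHom {X Y : FusionWord B.I} (M : B.integralMatrices A X Y) :
    (B.dec X).mat B.schur (B.dec Y) (toHom M) = M.1 := M.2.choose_spec.2

/-- The matrix of an integral morphism. -/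
noncomputable def ofHom {X Y : FusionWord B.I} (f : B.eval X ⟶ B.eval Y)
    (hf : B.IsIntegral A f) : B.integralMatrices A X Y := ⟨_, f, hf, rfl⟩

@[simp]
theorem toHom_ofHom {X Y : FusionWord B.I} (f : B.eval X ⟶ B.eval Y) (hf : B.IsIntegral A f) :
    toHom (ofHom f hf) = f :=
  Decomposition.mat_injective B.schur _ _ (mat_toHom (ofHom f hf))

theorem toHom_injective {X Y : FusionWord B.I} :
    Function.Injective (toHom : B.integralMatrices A X Y → _) := fun M N h =>
  Subtype.ext <| by rw [← mat_toHom, h, mat_toHom]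

theorem toHom_add {X Y : FusionWord B.I} (M N : B.integralMatrices A X Y) :
    toHom (M + N) = toHom M + toHom N :=
  Decomposition.mat_injective B.schur (B.dec X) (B.dec Y) <| by
    rw [map_add, mat_toHom, mat_toHom, mat_toHom]; rfl

theorem toHom_smul {X Y : FusionWord B.I} (a : A) (M : B.integralMatrices A X Y) :
    toHom (a • M) = (a : K) • toHom M :=
  Decomposition.mat_injective B.schur (B.dec X) (B.dec Y) <| by
    rw [map_smul, mat_toHom, mat_toHom]; rfl

/-- Taking matrices over `K` as morphisms places the category in the universe of `K`, whatever the
universes of `C`; a good reduction must live in `Type`. The axioms are checked in `C`, since a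
matrix determines its morphism. -/
noncomputable instance : Category.{w} (IntegralForm B A) where
  Hom X Y := B.integralMatrices A X.word Y.word
  id X := ofHom (𝟙 X.eval) (.id _)
  comp M N := ofHom (toHom M ≫ toHom N) ((isIntegral_toHom M).comp (isIntegral_toHom N))
  id_comp _ := toHom_injective <| by simp
  comp_id M := toHom_injective <| by simp
  assoc M N L := toHom_injective <| by simp

noncomputable instance (X Y : IntegralForm B A) : AddCommGroup (X ⟶ Y) :=
  inferInstanceAs (AddCommGroup (B.integralMatrices A X.word Y.word))

noncomputable instance (X Y : IntegralForm B A) : Module A (X ⟶ Y) :=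
  inferInstanceAs (Module A (B.integralMatrices A X.word Y.word))

variable (B A) in
/-- The functor from the integral form to the category. -/
noncomputable def functor : IntegralForm B A ⥤ C where
  obj X := X.eval
  map M := toHom M
  map_id _ := toHom_ofHom _ _
  map_comp _ _ := toHom_ofHom _ _

/-- The morphism of the integral form that describes an integral morphism. -/
noncomputable def lift {X Y : IntegralForm B A} (f : X.eval ⟶ Y.eval) (hf : B.IsIntegral A f) :
    X ⟶ Y := ofHom f hf

@[simp]
theorem functor_map_lift {X Y : IntegralForm B A} (f : X.eval ⟶ Y.eval)
    (hf : B.IsIntegral A f) : (functor B A).map (lift f hf : X ⟶ Y) = f := toHom_ofHom f hf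

theorem isIntegral_map {X Y : IntegralForm B A} (f : X ⟶ Y) :
    B.IsIntegral A (X := X.word) (Y := Y.word) ((functor B A).map f) := isIntegral_toHom f

instance : (functor B A).Faithful where
  map_injective h := toHom_injective h

theorem hom_ext {X Y : IntegralForm B A} {f g : X ⟶ Y}
    (h : (functor B A).map f = (functor B A).map g) : f = g := (functor B A).map_injective h

theorem functor_map_add {X Y : IntegralForm B A} (f g : X ⟶ Y) :
    (functor B A).map (f + g) = (functor B A).map f + (functor B A).map g := toHom_add f g

theorem functor_map_smul {X Y : IntegralForm B A} (a : A) (f : X ⟶ Y) :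
    (functor B A).map (a • f) = (a : K) • (functor B A).map f := toHom_smul a f

noncomputable instance : Preadditive (IntegralForm B A) where
  add_comp X Y Z f f' g := hom_ext <| by
    simp only [Functor.map_comp, functor_map_add, Preadditive.add_comp]
  comp_add X Y Z f g g' := hom_ext <| by
    simp only [Functor.map_comp, functor_map_add, Preadditive.comp_add]

instance : (functor B A).Additive where
  map_add := functor_map_add _ _

noncomputable instance : Linear A (IntegralForm B A) where
  smul_comp X Y Z r f g := hom_ext <| by
    simp only [Functor.map_comp, functor_map_smul, Linear.smul_comp]
  comp_smul X Y Z f r g := hom_ext <| by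
    simp only [Functor.map_comp, functor_map_smul, Linear.comp_smul]

theorem lift_comp_lift {X Y Z : IntegralForm B A} {f : X.eval ⟶ Y.eval} {g : Y.eval ⟶ Z.eval}
    {k : X.eval ⟶ Z.eval} (hf : B.IsIntegral A f) (hg : B.IsIntegral A g)
    (hk : B.IsIntegral A k) (h : f ≫ g = k) :
    (lift f hf : X ⟶ Y) ≫ (lift g hg : Y ⟶ Z) = lift k hk :=
  hom_ext <| ((functor B A).map_comp _ _).trans <|
    (congrArg₂ (· ≫ ·) (functor_map_lift f hf) (functor_map_lift g hg)).trans <|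
      h.trans (functor_map_lift k hk).symm

theorem lift_zero {X Y : IntegralForm B A} (h : B.IsIntegral A (0 : X.eval ⟶ Y.eval)) :
    (lift 0 h : X ⟶ Y) = 0 :=
  hom_ext <| (functor_map_lift _ h).trans ((functor B A).map_zero X Y).symm

theorem sum_lift {X Y : IntegralForm B A} {J : Type} [Fintype J] {f : J → (X.eval ⟶ Y.eval)}
    {g : X.eval ⟶ Y.eval} (hf : ∀ j, B.IsIntegral A (f j)) (hg : B.IsIntegral A g)
    (h : ∑ j, f j = g) : ∑ j, (lift (f j) (hf j) : X ⟶ Y) = lift g hg :=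
  hom_ext <| ((functor B A).map_sum _ _).trans <|
    (Finset.sum_congr rfl fun j _ => functor_map_lift (f j) (hf j)).trans <|
      h.trans (functor_map_lift g hg).symm

/-- An isomorphism that is integral in both directions. -/
noncomputable def liftIso {X Y : IntegralForm B A} (e : X.eval ≅ Y.eval)
    (h : B.IsIntegral A e.hom) (h' : B.IsIntegral A e.inv) : X ≅ Y where
  hom := lift e.hom h
  inv := lift e.inv h'
  hom_inv_id := lift_comp_lift _ _ (.id _) e.hom_inv_id
  inv_hom_id := lift_comp_lift _ _ (.id _) e.inv_hom_id

/-- The objects of the integral form that describe the members of the family. -/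
abbrev simple (B : FusionBasis K C) (A : Subring K) (i : B.I) : IntegralForm B A :=
  ⟨.simple i⟩

/-- The decomposition of an object of the integral form. -/
noncomputable def decomposition (X : IntegralForm B A) : Decomposition (simple B A) X where
  J := (B.dec X.word).J
  index := (B.dec X.word).index
  incl j := lift (X := simple B A _) ((B.dec X.word).incl j) (.incl _ j)
  proj j := lift (Y := simple B A _) ((B.dec X.word).proj j) (.proj _ j)
  incl_proj j := lift_comp_lift _ _ (.id _) ((B.dec X.word).incl_proj j)
  incl_proj_ne j k h := (lift_comp_lift _ _ .zero ((B.dec X.word).incl_proj_ne j k h)).trans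
    (lift_zero _)
  total := (Finset.sum_congr rfl fun j _ => lift_comp_lift _ _
    ((IsIntegralHom.proj _ j).comp (.incl _ j)) rfl).trans
      (sum_lift _ (.id _) (B.dec X.word).total)

/-- An endomorphism of a member is a scalar of `K`, and integrality of its one-by-one matrix puts
this scalar in `A`. -/
theorem schurFamily : SchurFamily A (simple B A) where
  end_bijective i := by
    have key (a : A) : (functor B A).map (a • 𝟙 (simple B A i)) = (a : K) • 𝟙 (B.obj i) :=
      (functor_map_smul _ _).trans (congrArg ((a : K) • ·) ((functor B A).map_id _))
    refine ⟨fun a b h => ?_, fun f => ?_⟩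
    · have h' : (a : K) • 𝟙 (B.obj i) = (b : K) • 𝟙 (B.obj i) :=
        (key a).symm.trans ((congrArg (functor B A).map h).trans (key b))
      exact Subtype.ext ((B.schur.end_bijective i).1 h')
    · obtain ⟨r, hr⟩ := (B.schur.end_bijective i).2 ((functor B A).map f)
      -- The sole entry of the matrix, with the identity inclusion and projection of
      -- `Decomposition.single` written out.
      have hmem : B.schur.coef i i (𝟙 (B.obj i) ≫ (r • 𝟙 (B.obj i)) ≫ 𝟙 (B.obj i)) ∈ A := by
        have h : B.IsIntegral A (X := .simple i) (Y := .simple i) ((functor B A).map f) :=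
          isIntegral_map f
        rw [← hr] at h
        exact h () ()
      rw [Category.comp_id, Category.id_comp, B.schur.coef_smul_id] at hmem
      exact ⟨⟨r, hmem⟩, hom_ext ((key _).trans hr)⟩
  hom_eq_zero i j h f := hom_ext <| by
    rw [Functor.map_zero]; exact B.schur.hom_eq_zero i j h _

/-- The direct sum is the formal one; its structure maps in `C` are integral by `ι_sum` and `π_sum`.
-/
instance : HasFiniteBiproducts (IntegralForm B A) where
  out n := ⟨fun f => by
    let X : IntegralForm B A := ⟨.sum n fun m => (f m).word⟩
    have hι (m) : B.IsIntegral A (X := (f m).word) (Y := X.word)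
      (biproduct.ι (fun m => (f m).eval) m) := .ι_sum (fun m => B.dec (f m).word) m
    have hπ (m) : B.IsIntegral A (X := X.word) (Y := (f m).word)
      (biproduct.π (fun m => (f m).eval) m) := .π_sum (fun m => B.dec (f m).word) m
    refine ⟨⟨⟨X, fun m => lift _ (hπ m), fun m => lift _ (hι m), ?_⟩, isBilimitOfTotal _ ?_⟩⟩
    · intro i j
      split_ifs with h
      · subst h
        exact lift_comp_lift _ _ (.id _) (biproduct.ι_π_self (fun m => (f m).eval) i)
      · exact (lift_comp_lift _ _ .zero (biproduct.ι_π_ne (fun m => (f m).eval) h)).trans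
          (lift_zero _)
    · exact (Finset.sum_congr rfl fun m _ => lift_comp_lift (hπ m) (hι m) ((hπ m).comp (hι m))
        rfl).trans
        (sum_lift _ (.id _) biproduct.total)⟩

/-! ### The monoidal structure of the integral form -/

variable [MonoidalLinear K C] [hA : B.IsDefinedOver A]

/-- The tensor product of words is formal, so its decomposition is by definition
`Decomposition.tensor`, the one for which integrality of tensor products and coherence isomorphisms
has been proved. -/
noncomputable instance : MonoidalCategoryStruct (IntegralForm B A) where
  tensorObj X Y := ⟨.tensor X.word Y.word⟩
  tensorUnit := ⟨.unit⟩
  whiskerLeft X _ _ f := lift (X.eval ◁ (functor B A).map f) ((isIntegral_map f).whiskerLeft _)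
  whiskerRight f Y := lift ((functor B A).map f ▷ Y.eval) ((isIntegral_map f).whiskerRight _)
  tensorHom f g := lift ((functor B A).map f ⊗ₘ (functor B A).map g)
    ((isIntegral_map f).tensorHom (isIntegral_map g))
  associator X Y Z := liftIso (α_ X.eval Y.eval Z.eval)
    (.associator_hom hA.associator_hom _ _ _) (.associator_inv hA.associator_inv _ _ _)
  leftUnitor X := liftIso (λ_ X.eval) (.leftUnitor_hom hA.leftUnitor_hom _)
    (.leftUnitor_inv hA.leftUnitor_inv _)
  rightUnitor X := liftIso (ρ_ X.eval) (.rightUnitor_hom hA.rightUnitor_hom _)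
    (.rightUnitor_inv hA.rightUnitor_inv _)

variable (B A) in
/-- The functor from the integral form to the category preserves the monoidal structure. -/
noncomputable def inducingData : Monoidal.InducingFunctorData (functor B A) where
  μIso X Y := Iso.refl (X.eval ⊗ Y.eval)
  whiskerLeft_eq X _ _ f := (functor_map_lift _ _).trans
    ((Category.id_comp _).trans (Category.comp_id _)).symm
  whiskerRight_eq f Y := (functor_map_lift _ _).trans
    ((Category.id_comp _).trans (Category.comp_id _)).symm
  tensorHom_eq f g := (functor_map_lift _ _).trans
    ((Category.id_comp _).trans (Category.comp_id _)).symm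
  εIso := Iso.refl (𝟙_ C)
  associator_eq X Y Z := (functor_map_lift _ (.associator_hom hA.associator_hom _ _ _)).trans <| by
    have : (α_ X.eval Y.eval Z.eval).hom =
        (((Iso.refl ((X.eval ⊗ Y.eval) ⊗ Z.eval)).symm ≪≫
          ((Iso.refl (X.eval ⊗ Y.eval)).symm ⊗ᵢ .refl _)) ≪≫ α_ X.eval Y.eval Z.eval ≪≫
            ((.refl _ ⊗ᵢ Iso.refl (Y.eval ⊗ Z.eval)) ≪≫
              Iso.refl (X.eval ⊗ Y.eval ⊗ Z.eval))).hom := by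
      simp
    exact this
  leftUnitor_eq X := (functor_map_lift _ (.leftUnitor_hom hA.leftUnitor_hom _)).trans <| by
    have : (λ_ X.eval).hom = (((Iso.refl (𝟙_ C ⊗ X.eval)).symm ≪≫
        ((Iso.refl (𝟙_ C)).symm ⊗ᵢ .refl _)) ≪≫ λ_ X.eval).hom := by
      simp
    exact this
  rightUnitor_eq X := (functor_map_lift _ (.rightUnitor_hom hA.rightUnitor_hom _)).trans <| by
    have : (ρ_ X.eval).hom = (((Iso.refl (X.eval ⊗ 𝟙_ C)).symm ≪≫
        (.refl _ ⊗ᵢ (Iso.refl (𝟙_ C)).symm)) ≪≫ ρ_ X.eval).hom := by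
      simp
    exact this

/-- The axioms hold in `C` and are reflected by the faithful functor. -/
noncomputable instance : MonoidalCategory (IntegralForm B A) :=
  Monoidal.induced (functor B A) (inducingData B A)

noncomputable instance : (functor B A).Monoidal :=
  Monoidal.fromInducedMonoidal (functor B A) (inducingData B A)

end IntegralForm
end FusionBasis

/-! ### Bilinearity of the tensor product and duals in the integral form -/

namespace FusionBasis.IntegralForm

variable {K : Type w} [Field K] {C : Type u} [Category.{v} C] [Preadditive C] [Linear K C]
  [HasFiniteBiproducts C] [MonoidalCategory C] [MonoidalPreadditive C]
  {B : FusionBasis K C} {A : Subring K} [MonoidalLinear K C] [hA : B.IsDefinedOver A]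

instance : MonoidalPreadditive (IntegralForm B A) :=
  monoidalPreadditive_of_faithful (functor B A)

theorem functor_map_whiskerLeft (X : IntegralForm B A) {Y Z : IntegralForm B A} (f : Y ⟶ Z) :
    (functor B A).map (X ◁ f) = X.eval ◁ (functor B A).map f :=
  functor_map_lift _ ((isIntegral_map f).whiskerLeft _)

theorem functor_map_whiskerRight {Y Z : IntegralForm B A} (f : Y ⟶ Z) (X : IntegralForm B A) :
    (functor B A).map (f ▷ X) = (functor B A).map f ▷ X.eval :=
  functor_map_lift _ ((isIntegral_map f).whiskerRight _)

instance : MonoidalLinear A (IntegralForm B A) where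
  whiskerLeft_smul X Y Z a f := hom_ext <| by
    rw [functor_map_whiskerLeft, functor_map_smul, functor_map_smul, functor_map_whiskerLeft]
    exact MonoidalLinear.whiskerLeft_smul _ _ _
  smul_whiskerRight a Y Z f X := hom_ext <| by
    rw [functor_map_whiskerRight, functor_map_smul, functor_map_smul, functor_map_whiskerRight]
    exact MonoidalLinear.smul_whiskerRight _ _ _

/-- An exact pairing given by integral morphisms. -/
@[reducible]
noncomputable def exactPairing (X Y : IntegralForm B A) [p : ExactPairing X.eval Y.eval]
    (hη : B.IsIntegral A (X := .unit) (Y := .tensor X.word Y.word) (η_ X.eval Y.eval))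
    (hε : B.IsIntegral A (X := .tensor Y.word X.word) (Y := .unit) (ε_ X.eval Y.eval)) :
    ExactPairing X Y :=
  letI : ExactPairing ((functor B A).obj X) ((functor B A).obj Y) := p
  .ofFaithful (functor B A) (lift (X := Y ⊗ X) (Y := 𝟙_ _) (ε_ X.eval Y.eval) hε)
    (lift (X := 𝟙_ _) (Y := X ⊗ Y) (η_ X.eval Y.eval) hη)
    ((functor_map_lift _ hε).trans ((Category.id_comp _).trans (Category.comp_id _)).symm)
    ((functor_map_lift _ hη).trans ((Category.id_comp _).trans (Category.comp_id _)).symm)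

/-- `IsDefinedOver` supplies integral pairings for the members, and `ExactPairing.ofSum` assembles
them along a decomposition. -/
theorem exists_exactPairing_right (X : IntegralForm B A) :
    ∃ Y : IntegralForm B A, Nonempty (ExactPairing X Y) := by
  have h (i : B.I) : ∃ Y : IntegralForm B A, Nonempty (ExactPairing (simple B A i) Y) := by
    obtain ⟨Y, p, hη, hε⟩ := hA.exists_rightDual i
    exact ⟨⟨Y⟩, ⟨exactPairing (simple B A i) ⟨Y⟩ (p := p) hη hε⟩⟩
  choose Y p using h
  let d := decomposition X
  have : HasBiproduct fun j => Y (d.index j) := HasBiproductsOfShape.has_biproduct _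
  let e := Decomposition.biproduct Y d.index
  have (j : d.J) : ExactPairing (simple B A (d.index j)) (Y (d.index j)) := (p _).some
  exact ⟨_, ⟨.ofSum (y := fun j => Y (d.index j)) d.incl d.proj e.incl e.proj d.incl_proj
    d.incl_proj_ne d.total
    e.incl_proj e.incl_proj_ne e.total⟩⟩

theorem exists_exactPairing_left (X : IntegralForm B A) :
    ∃ Y : IntegralForm B A, Nonempty (ExactPairing Y X) := by
  have h (i : B.I) : ∃ Y : IntegralForm B A, Nonempty (ExactPairing Y (simple B A i)) := by
    obtain ⟨Y, p, hη, hε⟩ := hA.exists_leftDual i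
    exact ⟨⟨Y⟩, ⟨exactPairing ⟨Y⟩ (simple B A i) (p := p) hη hε⟩⟩
  choose Y p using h
  let d := decomposition X
  have : HasBiproduct fun j => Y (d.index j) := HasBiproductsOfShape.has_biproduct _
  let e := Decomposition.biproduct Y d.index
  have (j : d.J) : ExactPairing (Y (d.index j)) (simple B A (d.index j)) := (p _).some
  exact ⟨_, ⟨.ofSum (J := d.J) (x := fun j => Y (d.index j)) e.incl e.proj d.incl d.proj e.incl_proj
    e.incl_proj_ne e.total
    d.incl_proj d.incl_proj_ne d.total⟩⟩

noncomputable instance : RigidCategory (IntegralForm B A) where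
  rightDual X :=
    { rightDual := (exists_exactPairing_right X).choose
      exact := (exists_exactPairing_right X).choose_spec.some }
  leftDual X :=
    { leftDual := (exists_exactPairing_left X).choose
      exact := (exists_exactPairing_left X).choose_spec.some }

end FusionBasis.IntegralForm

/-! ### Comparison of Grothendieck rings -/

section

variable {C : Type u₁} [Category.{v₁} C] [Preadditive C] [HasFiniteBiproducts C]
  [MonoidalCategory C] {D : Type u₂} [Category.{v₂} D] [Preadditive D] [HasFiniteBiproducts D]
  [MonoidalCategory D]

namespace GrothendieckRing

/-- The homomorphism of Grothendieck rings induced by an additive map of isomorphism classes. -/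
noncomputable def map (m : Skeleton C →* Skeleton D)
    (hm : ∀ X Y : C, RingQuot.mkRingHom (GrothendieckRel D) (.of (m (toSkeleton (X ⊞ Y)))) =
      RingQuot.mkRingHom (GrothendieckRel D) (.of (m (toSkeleton X))) +
        RingQuot.mkRingHom (GrothendieckRel D) (.of (m (toSkeleton Y)))) :
    GrothendieckRing C →+* GrothendieckRing D :=
  RingQuot.lift ⟨FreeAbelianGroup.liftMonoid (((RingQuot.mkRingHom (GrothendieckRel D) :
    FreeAbelianGroup (Skeleton D) →* GrothendieckRing D).comp FreeAbelianGroup.ofMulHom).comp m), by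
    rintro _ _ ⟨X, Y⟩
    simpa using hm X Y⟩

theorem map_of (m : Skeleton C →* Skeleton D) (hm) (s : Skeleton C) :
    map m hm (RingQuot.mkRingHom (GrothendieckRel C) (.of s)) =
      RingQuot.mkRingHom (GrothendieckRel D) (.of (m s)) := by
  rw [map, RingQuot.lift_mkRingHom_apply]
  simp

theorem ringHom_ext {T : Type*} [Ring T] {f g : GrothendieckRing C →+* T}
    (h : ∀ s : Skeleton C, f (RingQuot.mkRingHom (GrothendieckRel C) (.of s)) =
      g (RingQuot.mkRingHom (GrothendieckRel C) (.of s))) : f = g := by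
  refine RingQuot.ringQuot_ext _ _ (RingHom.ext fun a => ?_)
  exact DFunLike.congr_fun (FreeAbelianGroup.lift_ext
    ((f.comp (RingQuot.mkRingHom (GrothendieckRel C))).toAddMonoidHom)
    ((g.comp (RingQuot.mkRingHom (GrothendieckRel C))).toAddMonoidHom) h) a

/-- The isomorphism of Grothendieck rings induced by an additive bijection of isomorphism
classes. -/
noncomputable def congr (m : Skeleton C →* Skeleton D) (m' : Skeleton D →* Skeleton C)
    (h : ∀ s, m' (m s) = s) (h' : ∀ s, m (m' s) = s)
    (hm : ∀ X Y : C, RingQuot.mkRingHom (GrothendieckRel D) (.of (m (toSkeleton (X ⊞ Y)))) =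
      RingQuot.mkRingHom (GrothendieckRel D) (.of (m (toSkeleton X))) +
        RingQuot.mkRingHom (GrothendieckRel D) (.of (m (toSkeleton Y))))
    (hm' : ∀ X Y : D, RingQuot.mkRingHom (GrothendieckRel C) (.of (m' (toSkeleton (X ⊞ Y)))) =
      RingQuot.mkRingHom (GrothendieckRel C) (.of (m' (toSkeleton X))) +
        RingQuot.mkRingHom (GrothendieckRel C) (.of (m' (toSkeleton Y)))) :
    GrothendieckRing C ≃+* GrothendieckRing D :=
  RingEquiv.ofRingHom (map m hm) (map m' hm')
    (ringHom_ext fun s => by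
      rw [RingHom.comp_apply, map_of, map_of, h', RingHom.id_apply])
    (ringHom_ext fun s => by
      rw [RingHom.comp_apply, map_of, map_of, h, RingHom.id_apply])

end GrothendieckRing

/-- Two categories with the same isomorphism classes of objects, compatibly with direct sums,
tensor products and simple objects, have the same Grothendieck ring. -/
theorem sameGrothendieckRing_of_map (φ : C → D)
    (h_iso : ∀ X Y, Nonempty (X ≅ Y) ↔ Nonempty (φ X ≅ φ Y))
    (h_surj : ∀ Z, ∃ X, Nonempty (φ X ≅ Z)) (h_unit : Nonempty (φ (𝟙_ C) ≅ 𝟙_ D))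
    (h_tensor : ∀ X Y, Nonempty (φ (X ⊗ Y) ≅ φ X ⊗ φ Y))
    (h_biprod : ∀ X Y, Nonempty (φ (X ⊞ Y) ≅ φ X ⊞ φ Y))
    (h_simple : ∀ X, Simple X ↔ Simple (φ X)) : SameGrothendieckRing C D := by
  -- Only isomorphism classes enter, so `φ` need not be a functor. This matters because the
  -- reduction modulo `p` is compared with a category over a field of characteristic zero.
  let m₀ : Skeleton C → Skeleton D := Quotient.map φ fun X Y h => (h_iso X Y).1 h
  have hm₀ (X : C) : m₀ (toSkeleton X) = toSkeleton (φ X) := rfl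
  have ex (s : Skeleton C) : ∃ X, toSkeleton X = s := ⟨_, Quotient.out_eq s⟩
  have ex' (s : Skeleton D) : ∃ X, toSkeleton (φ X) = s := by
    obtain ⟨Z, rfl⟩ : ∃ Z, toSkeleton Z = s := ⟨_, Quotient.out_eq s⟩
    obtain ⟨X, ⟨e⟩⟩ := h_surj Z
    exact ⟨X, congr_toSkeleton_of_iso e⟩
  have hbij : Function.Bijective m₀ := by
    refine ⟨fun s t h => ?_, fun s => ?_⟩
    · obtain ⟨X, rfl⟩ := ex s
      obtain ⟨Y, rfl⟩ := ex t
      exact toSkeleton_eq_toSkeleton_iff.2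
        ((h_iso X Y).2 (toSkeleton_eq_toSkeleton_iff.1 h))
    · obtain ⟨X, rfl⟩ := ex' s
      exact ⟨toSkeleton X, rfl⟩
  let m : Skeleton C →* Skeleton D :=
    { toFun := m₀
      map_one' := congr_toSkeleton_of_iso h_unit.some
      map_mul' := fun s t => by
        obtain ⟨X, rfl⟩ := ex s
        obtain ⟨Y, rfl⟩ := ex t
        rw [← Skeleton.toSkeleton_tensorObj, hm₀, hm₀, hm₀, ← Skeleton.toSkeleton_tensorObj]
        exact congr_toSkeleton_of_iso (h_tensor X Y).some }
  have hm (X : C) : m (toSkeleton X) = toSkeleton (φ X) := rfl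
  let n : Skeleton D →* Skeleton C := (MulEquiv.ofBijective m hbij).symm.toMonoidHom
  have hn (s) : n (m s) = s := (MulEquiv.ofBijective m hbij).symm_apply_apply s
  have hn' (s) : m (n s) = s := (MulEquiv.ofBijective m hbij).apply_symm_apply s
  have hm' (X : C) : n (toSkeleton (φ X)) = toSkeleton X := hn (toSkeleton X)
  have hsum (X Y : C) : toSkeleton (φ (X ⊞ Y)) = toSkeleton (φ X ⊞ φ Y) :=
    congr_toSkeleton_of_iso (h_biprod X Y).some
  let e := GrothendieckRing.congr m n hn hn'
    (fun X Y => by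
      rw [hm, hm, hm, hsum, ← map_add]
      exact RingQuot.mkRingHom_rel (.biprod _ _))
    (fun Z W => by
      -- Additivity of the inverse: up to isomorphism both objects are values of `φ`, where
      -- additivity is known.
      obtain ⟨X, hX⟩ := ex' (toSkeleton Z)
      obtain ⟨Y, hY⟩ := ex' (toSkeleton W)
      obtain ⟨i⟩ := toSkeleton_eq_toSkeleton_iff.1 hX
      obtain ⟨j⟩ := toSkeleton_eq_toSkeleton_iff.1 hY
      rw [← congr_toSkeleton_of_iso (biprod.mapIso i j), ← hsum, ← hX, ← hY, hm', hm', hm',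
        ← map_add]
      exact RingQuot.mkRingHom_rel (.biprod _ _))
  have he (X : C) : e (grothendieckClass X) = grothendieckClass (φ X) :=
    GrothendieckRing.map_of _ _ _
  refine ⟨e, Set.ext fun a => ⟨?_, ?_⟩⟩
  · rintro ⟨_, ⟨X, hX, rfl⟩, rfl⟩
    exact ⟨φ X, (h_simple X).1 hX, he X⟩
  · rintro ⟨Z, hZ, rfl⟩
    obtain ⟨X, ⟨i⟩⟩ := h_surj Z
    refine ⟨_, ⟨X, (h_simple X).2 (Simple.of_iso i), rfl⟩, (he X).trans ?_⟩
    exact congrArg (fun s => RingQuot.mkRingHom (GrothendieckRel D) (.of s))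
      (congr_toSkeleton_of_iso i)

end

/-! ### Algebraic numbers are integral at almost all primes -/

/-- Some nonzero integer multiple `d • a` is an algebraic integer. If `p` does not divide `d`, then
`d` is a unit at `p`, and `a` is integral there; the exceptions are among the prime factors of `d`.
-/
theorem finite_setOf_not_integral (ι : ∀ (p : ℕ) [Fact p.Prime], QBar →+* PadicAlgCl p)
    (a : QBar) : {p : ℕ | ∃ _ : Fact p.Prime, ι p a ∉ 𝒪[PadicAlgCl p]}.Finite := by
  obtain ⟨d, hd, hint⟩ := IsAlgebraic.exists_integral_multiple
    ((IsFractionRing.isAlgebraic_iff ℤ ℚ QBar).2 ((AlgebraicClosure.isAlgebraic ℚ).isAlgebraic a))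
  refine (Int.natAbs d).primeFactors.finite_toSet.subset ?_
  rintro p ⟨hp, ha⟩
  rw [Finset.mem_coe, Nat.mem_primeFactors]
  refine ⟨hp.out, ?_, by simpa using hd⟩
  by_contra hpd
  apply ha
  have hv : Valued.v (d : PadicAlgCl p) = 1 := by
    rw [← NNReal.coe_inj, PadicAlgCl.valuation_coe, ← map_intCast (algebraMap ℚ_[p] (PadicAlgCl p)),
      PadicAlgCl.norm_extends, NNReal.coe_one, Padic.norm_intCast_eq_one_iff,
      Int.isCoprime_iff_gcd_eq_one]
    exact ((hp.out.coprime_iff_not_dvd).2 hpd).symm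
  -- Valuation rings are integrally closed, and `ι p` preserves integrality over `ℤ`.
  have h : ι p (d • a) ∈ (Valued.v : Valuation (PadicAlgCl p) _).integer :=
    (Valuation.integer.integers Valued.v).mem_of_integral
      (hint.map (ι p).toIntAlgHom).tower_top
  rw [Valuation.mem_integer_iff, map_zsmul, zsmul_eq_mul, map_mul, hv, one_mul] at h
  exact h

/-! ### The simple objects of a fusion category -/

namespace FusionBasis

variable (K : Type*) [Field K] [IsAlgClosed K] (C : Type u) [Category.{v} C] [Abelian C]
  [Linear K C] [MonoidalCategory C] [MonoidalPreadditive C] [MonoidalLinear K C]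
  [RigidCategory C] [IsFusionCategory K C]

/-- Schur's lemma. Scalar endomorphism rings use that `K` is algebraically closed and that the
spaces of morphisms are finite dimensional. -/
theorem schurFamily_of_simple {I : Type} {x : I → C} (h : ∀ i, Simple (x i))
    (h' : ∀ i j, Nonempty (x i ≅ x j) → i = j) : SchurFamily K x where
  end_bijective i := by
    have := IsSemisimpleTensorCategory.finiteDimensional_hom (k := K) (x i) (x i)
    have := h i
    refine ⟨smul_left_injective K (id_nonzero (x i)), endomorphism_simple_eq_smul_id K⟩
  hom_eq_zero i j hij f := by
    have := h i
    have := h j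
    by_contra hf
    have := isIso_of_hom_simple hf
    exact hij (h' i j ⟨asIso f⟩)

/-- A fusion category over an algebraically closed field has a finite family of representatives
of the simple objects. -/
theorem nonempty : Nonempty (FusionBasis K C) := by
  obtain ⟨n, s, hs⟩ := IsFusionCategory.finite_simple (k := K) (C := C)
  -- The given list may contain non-simple objects and repetitions; the index set is the simple ones
  -- up to isomorphism.
  let r : Setoid {i : Fin n // Simple (s i)} :=
    (isIsomorphicSetoid C).comap fun i => s i.1
  let x (q : Quotient r) : C := s q.out.1
  have hx (X : C) [Simple X] : ∃ q, Nonempty (X ≅ x q) := by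
    obtain ⟨i, ⟨e⟩⟩ := hs X ‹_›
    let a : {i : Fin n // Simple (s i)} := ⟨i, Simple.of_iso e.symm⟩
    obtain ⟨e'⟩ : Nonempty (s (Quotient.mk r a).out.1 ≅ s i) := Quotient.mk_out (s := r) a
    exact ⟨⟦a⟧, ⟨e ≪≫ e'.symm⟩⟩
  refine ⟨{ I := Quotient r
            obj := x
            schur := schurFamily_of_simple K C (fun q => q.out.2) fun p q h => ?_
            decomposition := fun X => Classical.choice ?_ }⟩
  · exact Quotient.out_equiv_out.1 h
  · obtain ⟨m, t, ht, ⟨e⟩⟩ := IsSemisimpleTensorCategory.semisimple (k := K) X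
    choose a b using fun i => have := ht i; hx (t i)
    exact ⟨(Decomposition.biproduct x a).ofIso
      (biproduct.mapIso fun i => (b i).some.symm) |>.ofIso e.symm⟩

end FusionBasis

/-! ### Comparison of decompositions -/

namespace Decomposition

variable {E : Type u} [Category.{v} E] [Preadditive E] {I : Type} {x : I → E}
  {E' : Type u₁} [Category.{v₁} E'] [Preadditive E'] {y : I → E'}
  {E'' : Type u₂} [Category.{v₂} E''] [Preadditive E''] {z : I → E''}

/-- The same members of the family occur, with the same multiplicities, in two decompositions. -/
def SameIndex {X : E} {Y : E'} (d : Decomposition x X) (e : Decomposition y Y) : Prop :=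
  ∃ σ : d.J ≃ e.J, ∀ j, e.index (σ j) = d.index j

namespace SameIndex

theorem symm {X : E} {Y : E'} {d : Decomposition x X} {e : Decomposition y Y}
    (h : d.SameIndex e) : e.SameIndex d := by
  obtain ⟨σ, h⟩ := h
  exact ⟨σ.symm, fun j => by rw [← h, σ.apply_symm_apply]⟩

theorem trans {X : E} {Y : E'} {Z : E''} {d : Decomposition x X} {e : Decomposition y Y}
    {c : Decomposition z Z} (h : d.SameIndex e) (h' : e.SameIndex c) : d.SameIndex c := by
  obtain ⟨σ, h⟩ := h
  obtain ⟨τ, h'⟩ := h'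
  exact ⟨σ.trans τ, fun j => (h' _).trans (h j)⟩

end SameIndex

/-- The decomposition of a direct sum of two objects. -/
noncomputable def biprod {X Y : E} [HasBinaryBiproduct X Y] (d : Decomposition x X)
    (e : Decomposition x Y) : Decomposition x (X ⊞ Y) where
  J := d.J ⊕ e.J
  index := Sum.elim d.index e.index
  incl j := match j with
    | .inl j => d.incl j ≫ biprod.inl
    | .inr j => e.incl j ≫ biprod.inr
  proj j := match j with
    | .inl j => biprod.fst ≫ d.proj j
    | .inr j => biprod.snd ≫ e.proj j
  incl_proj j := by rcases j with j | j <;> simp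
  incl_proj_ne j k h := by
    rcases j with j | j <;> rcases k with k | k
    · have h' : j ≠ k := fun h' => h (congrArg _ h')
      exact (by simp [d.incl_proj_ne j k h'] :
        (d.incl j ≫ (biprod.inl : X ⟶ X ⊞ Y)) ≫ biprod.fst ≫ d.proj k = 0)
    · exact (by simp : (d.incl j ≫ (biprod.inl : X ⟶ X ⊞ Y)) ≫ biprod.snd ≫ e.proj k = 0)
    · exact (by simp : (e.incl j ≫ (biprod.inr : Y ⟶ X ⊞ Y)) ≫ biprod.fst ≫ d.proj k = 0)
    · have h' : j ≠ k := fun h' => h (congrArg _ h')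
      exact (by simp [e.incl_proj_ne j k h'] :
        (e.incl j ≫ (biprod.inr : Y ⟶ X ⊞ Y)) ≫ biprod.snd ≫ e.proj k = 0)
  total := by
    have h₁ : ∑ j : d.J, ((biprod.fst : X ⊞ Y ⟶ X) ≫ d.proj j) ≫ d.incl j ≫
        (biprod.inl : X ⟶ X ⊞ Y) =
        (biprod.fst : X ⊞ Y ⟶ X) ≫ (biprod.inl : X ⟶ X ⊞ Y) := by
      have := congrArg (fun f => (biprod.fst : X ⊞ Y ⟶ X) ≫ f ≫ (biprod.inl : X ⟶ X ⊞ Y)) d.total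
      simpa [Preadditive.sum_comp, Preadditive.comp_sum] using this
    have h₂ : ∑ j : e.J, ((biprod.snd : X ⊞ Y ⟶ Y) ≫ e.proj j) ≫ e.incl j ≫
        (biprod.inr : Y ⟶ X ⊞ Y) =
        (biprod.snd : X ⊞ Y ⟶ Y) ≫ (biprod.inr : Y ⟶ X ⊞ Y) := by
      have := congrArg (fun f => (biprod.snd : X ⊞ Y ⟶ Y) ≫ f ≫ (biprod.inr : Y ⟶ X ⊞ Y)) e.total
      simpa [Preadditive.sum_comp, Preadditive.comp_sum] using this
    exact (Fintype.sum_sum_type _).trans ((congrArg₂ (· + ·) h₁ h₂).trans biprod.total)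

theorem SameIndex.biprod {X Y : E} {X' Y' : E'} [HasBinaryBiproduct X Y]
    [HasBinaryBiproduct X' Y'] {d : Decomposition x X} {e : Decomposition x Y}
    {d' : Decomposition y X'} {e' : Decomposition y Y'} (h : d.SameIndex d')
    (h' : e.SameIndex e') : (d.biprod e).SameIndex (d'.biprod e') := by
  obtain ⟨σ, h⟩ := h
  obtain ⟨τ, h'⟩ := h'
  exact ⟨Equiv.sumCongr σ τ, Sum.rec h h'⟩

theorem SameIndex.single (x : I → E) (y : I → E') (i : I) :
    (Decomposition.single x i).SameIndex (Decomposition.single y i) :=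
  ⟨Equiv.refl _, fun _ => rfl⟩

end Decomposition

/-- Two semisimple tensor categories with the same index sets for the simple objects and with the
same multiplicities have the same Grothendieck ring. -/
theorem sameGrothendieckRing_of_decomposition {k : Type*} [Field k] {k' : Type*} [Field k']
    {E : Type u₁} [Category.{v₁} E] [Preadditive E] [HasFiniteBiproducts E] [Linear k E]
    [MonoidalCategory E] {E' : Type u₂} [Category.{v₂} E'] [Preadditive E']
    [HasFiniteBiproducts E'] [Linear k' E'] [MonoidalCategory E']
    {I : Type} {x : I → E} {y : I → E'} (hx : SchurFamily k x) (hy : SchurFamily k' y)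
    (φ : E → E') (d : ∀ X, Decomposition x X) (d' : ∀ X, Decomposition y (φ X))
    (h : ∀ X, (d X).SameIndex (d' X)) (h_surj : ∀ Z, ∃ X, Nonempty (φ X ≅ Z))
    (h_unit : Nonempty (φ (𝟙_ E) ≅ 𝟙_ E'))
    (h_tensor : ∀ X Y, Nonempty (φ (X ⊗ Y) ≅ φ X ⊗ φ Y)) : SameGrothendieckRing E E' := by
  have hd (X : E) : Nonempty (Decomposition x X) := ⟨d X⟩
  have hd' (Z : E') : Nonempty (Decomposition y Z) := by
    obtain ⟨X, ⟨e⟩⟩ := h_surj Z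
    exact ⟨(d' X).ofIso e⟩
  refine sameGrothendieckRing_of_map φ (fun X Y => ?_) h_surj h_unit h_tensor (fun X Y => ?_)
    fun X => ?_
  -- On both sides isomorphism means equality of multiplicities, and `h` says that these agree
  -- across the two categories.
  · rw [(d X).nonempty_iso_iff hx (d Y), (d' X).nonempty_iso_iff hy (d' Y)]
    exact ⟨fun H => ((h X).symm.trans H).trans (h Y), fun H => ((h X).trans H).trans (h Y).symm⟩
  · rw [(d' (X ⊞ Y)).nonempty_iso_iff hy ((d' X).biprod (d' Y))]
    have H : (d (X ⊞ Y)).SameIndex ((d X).biprod (d Y)) :=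
      ((d (X ⊞ Y)).nonempty_iso_iff hx _).1 ⟨Iso.refl _⟩
    exact ((h _).symm.trans H).trans ((h X).biprod (h Y))
  · rw [hx.simple_iff hd, hy.simple_iff hd']
    refine exists_congr fun i => ?_
    rw [(d X).nonempty_iso_iff hx (.single x i), (d' X).nonempty_iso_iff hy (.single y i)]
    exact ⟨fun H => ((h X).symm.trans H).trans (.single x y i),
      fun H => ((h X).trans H).trans (Decomposition.SameIndex.single x y i).symm⟩

/-! ### Semisimple tensor categories from Schur families -/

namespace SchurFamily

theorem isSemisimpleTensorCategoryOverRing {R : Type*} [CommRing R] {E : Type u} [Category.{v} E]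
    [Preadditive E] [HasFiniteBiproducts E] [Linear R E] [MonoidalCategory E]
    [MonoidalPreadditive E] [MonoidalLinear R E] [RigidCategory E] {I : Type} {x : I → E}
    (hx : SchurFamily R x) (hd : ∀ X, Nonempty (Decomposition x X)) {i : I} (e : 𝟙_ E ≅ x i) :
    IsSemisimpleTensorCategoryOverRing R E where
  end_unit := by
    have : (fun r : R => r • 𝟙 (𝟙_ E)) =
        (fun f => e.hom ≫ f ≫ e.inv) ∘ fun r : R => r • 𝟙 (x i) := by
      ext r; simp
    rw [this]
    refine Function.Bijective.comp ?_ (hx.end_bijective i)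
    exact Function.bijective_iff_has_inverse.2 ⟨fun f => e.inv ≫ f ≫ e.hom,
      fun f => by simp, fun f => by simp⟩
  split := by
    -- The definition asks for an index type in the universe of the objects, hence the lift.
    refine ⟨ULift I, fun i => x i.down, fun i => hx.end_bijective _,
      fun i j h f => hx.hom_eq_zero _ _ (fun h' => h (ULift.ext _ _ h')) f, fun X => ?_⟩
    obtain ⟨n, a, h⟩ := (hd X).some.exists_fin_biproduct
    exact ⟨n, fun m => ⟨a m⟩, h⟩

theorem isSemisimpleTensorCategory {k : Type*} [Field k] {E : Type u} [Category.{v} E]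
    [Abelian E] [Linear k E] [MonoidalCategory E]
    [MonoidalPreadditive E] [MonoidalLinear k E] [RigidCategory E] {I : Type} {x : I → E}
    (hx : SchurFamily k x) (hd : ∀ X, Nonempty (Decomposition x X)) {i : I} (e : 𝟙_ E ≅ x i) :
    IsSemisimpleTensorCategory k E where
  finiteDimensional_hom X Y := (hd X).some.finiteDimensional_hom' hx (hd Y).some
  simple_unit := (hx.simple_iff hd _).2 ⟨i, ⟨e⟩⟩
  semisimple X := by
    obtain ⟨n, a, h⟩ := (hd X).some.exists_fin_biproduct
    exact ⟨n, fun m => x (a m), fun m => hx.simple hd _, h⟩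

end SchurFamily

namespace FusionBasis.IntegralForm

/-! ### Extensions of scalars of the integral form -/

variable {K : Type w} [Field K] {C : Type u} [Category.{v} C] [Preadditive C] [Linear K C]
  [HasFiniteBiproducts C] [MonoidalCategory C] [MonoidalPreadditive C]
  (B : FusionBasis K C) (A : Subring K) [MonoidalLinear K C] [hA : B.IsDefinedOver A]

/-- The isomorphism `e` itself need not be integral, nor its inverse. It is used only to match the
summands of the unit with the single summand of `B.obj i`; the matching then gives an isomorphism
over `A`. -/
theorem nonempty_tensorUnit_iso {i : B.I} (e : 𝟙_ C ≅ B.obj i) :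
    Nonempty (𝟙_ (IntegralForm B A) ≅ simple B A i) := by
  obtain ⟨σ, h⟩ := ((B.dec .unit).nonempty_iso_iff B.schur (.single B.obj i)).1 ⟨e⟩
  exact ⟨(decomposition (𝟙_ (IntegralForm B A))).isoOfEquiv (.single _ i) σ h⟩

/-- The integral form becomes equivalent to the category over an extension of the field. -/
theorem tensorEquivalent (S : Type*) [CommRing S] [Algebra A S] (T : Type*) [Field T]
    [Algebra K T] [Algebra S T]
    (h : ∀ a : A, algebraMap S T (algebraMap A S a) = algebraMap K T a) :
    TensorEquivalent T (ScalarExtension S T (ScalarExtension A S (IntegralForm B A)))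
      (ScalarExtension K T C) := by
  -- The functor to `C`, followed by extension to `T`, is extended twice: semilinearly along `S →
  -- T`, and then linearly over `T`. The hypothesis `h` makes the two routes from `A` to `T` agree.
  let H₀ : IntegralForm B A ⥤ ScalarExtension K T C :=
    functor B A ⋙ ScalarExtension.incl K T C
  have h₀ {X Y : IntegralForm B A} (a : A) (f : X ⟶ Y) :
      H₀.map (a • f) = algebraMap S T (algebraMap A S a) • H₀.map f := by
    rw [h]
    refine (congrArg (ScalarExtension.incl K T C).map (functor_map_smul a f)).trans ?_
    refine (ScalarExtension.homMk_smul (a : K) (1 : T) _).trans ?_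
    rw [Algebra.smul_def]
    rfl
  let H₁ := ScalarExtension.extend (algebraMap S T) H₀ h₀
  have h₁ {X Y : ScalarExtension A S (IntegralForm B A)} (s : S) (f : X ⟶ Y) :
      H₁.map (s • f) = RingHom.id T (algebraMap S T s) • H₁.map f :=
    ScalarExtension.extend_map_smul _ _ _ s f
  let H₂ := ScalarExtension.extend (RingHom.id T) H₁ h₁
  have : H₂.Linear T := ⟨fun f t => ScalarExtension.extend_map_smul _ _ _ t f⟩
  have hx : SchurFamily T fun i => (ScalarExtension.incl S T _).obj
      ((ScalarExtension.incl A S _).obj (simple B A i)) :=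
    ScalarExtension.schurFamily (ScalarExtension.schurFamily schurFamily)
  -- `H₂` carries the twice extended family to the extension of `B.obj`, which is again a Schur
  -- family, so no general spaces of morphisms have to be compared.
  obtain ⟨_, _⟩ := hx.full_faithful (ScalarExtension.nonempty_decomposition
    (ScalarExtension.nonempty_decomposition fun X => ⟨decomposition X⟩)) H₂
    (ScalarExtension.schurFamily B.schur)
  have : H₂.EssSurj := ⟨fun Z => by
    obtain ⟨Y, ⟨e⟩⟩ := B.exists_iso_eval Z.obj
    exact ⟨⟨⟨⟨Y⟩⟩⟩, ⟨(ScalarExtension.incl K T C).mapIso e.symm⟩⟩⟩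
  exact ⟨H₂, inferInstance, {}, inferInstance, inferInstance⟩

/-- The reduction of the integral form has the same Grothendieck ring as the category. -/
theorem sameGrothendieckRing (S : Type*) [CommRing S] [Algebra A S] (k : Type*) [Field k]
    [Algebra S k] :
    SameGrothendieckRing (ScalarExtension S k (ScalarExtension A S (IntegralForm B A))) C :=
  sameGrothendieckRing_of_decomposition
    (ScalarExtension.schurFamily (S := k) (ScalarExtension.schurFamily (S := S) schurFamily))
    B.schur (fun X => X.obj.obj.eval)
    (fun X => ((decomposition X.obj.obj).map (ScalarExtension.incl A S _)).map
      (ScalarExtension.incl S k _))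
    -- A word has the same summands in the reduction as in `C`, since both decompositions are built
    -- from `B.dec`.
    (fun X => B.dec X.obj.obj.word) (fun X => ⟨Equiv.refl _, fun _ => rfl⟩)
    (fun Z => by
      obtain ⟨Y, ⟨e⟩⟩ := B.exists_iso_eval Z
      exact ⟨⟨⟨⟨Y⟩⟩⟩, ⟨e.symm⟩⟩)
    ⟨Iso.refl _⟩ fun X Y => ⟨Iso.refl _⟩

end FusionBasis.IntegralForm

/-! ### Good reductions -/

section

variable {p : ℕ} [Fact p.Prime] (ι : QBar →+* PadicAlgCl p)
  {C : Type u} [Category.{v} C] [Abelian C] [Linear QBar C] [MonoidalCategory C]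
  [MonoidalPreadditive C] [MonoidalLinear QBar C] [RigidCategory C]

/-- A lift whose special fibre has a finite Schur family that generates it gives a good
reduction. -/
theorem IsGoodPrime.of_lift {E : Type} [Category.{0} E] [Preadditive E] [HasFiniteBiproducts E]
    [Linear (ZpBar p) E] [MonoidalCategory E] [MonoidalPreadditive E]
    [MonoidalLinear (ZpBar p) E] [RigidCategory E] {I : Type} [Finite I] {x : I → E}
    (hx : SchurFamily (ZpBar p) x) (hd : ∀ X, Nonempty (Decomposition x X)) {i : I}
    (e : 𝟙_ E ≅ x i)
    (h : SameGrothendieckRing (ScalarExtension (ZpBar p) (FpBar p) E) C)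
    (h' : letI := ι.toAlgebra
      TensorEquivalent (PadicAlgCl p) (ScalarExtension (ZpBar p) (PadicAlgCl p) E)
        (ScalarExtension QBar (PadicAlgCl p) C)) : IsGoodPrime p ι C := by
  let F := ScalarExtension.incl (ZpBar p) (FpBar p) E
  have hx' : SchurFamily (FpBar p) fun i => F.obj (x i) := ScalarExtension.schurFamily hx
  have hd' : ∀ X, Nonempty (Decomposition (fun i => F.obj (x i)) X) :=
    ScalarExtension.nonempty_decomposition hd
  have e' : 𝟙_ (ScalarExtension (ZpBar p) (FpBar p) E) ≅ F.obj (x i) := F.mapIso e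
  -- The reduction is the special fibre of the lift itself, so the identity functor is the required
  -- equivalence. The abelian structure is built on the given preadditive structure, which lets the
  -- linear and monoidal instances be reused.
  exact ⟨@GoodReduction.mk p _ ι C _ _ _ _ _ _ _ (ScalarExtension (ZpBar p) (FpBar p) E) _
    (hx'.abelian hd') (inferInstanceAs (Linear (FpBar p) (ScalarExtension (ZpBar p) (FpBar p) E)))
    _ (inferInstanceAs (MonoidalPreadditive (ScalarExtension (ZpBar p) (FpBar p) E)))
    (inferInstanceAs (MonoidalLinear (FpBar p) (ScalarExtension (ZpBar p) (FpBar p) E))) _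
    (@SchurFamily.isSemisimpleTensorCategory (FpBar p) _ _ _ (hx'.abelian hd') _ _ _ _ _ _ _
      hx' hd' i e') h E _ _ _ _ _ _ _ _ (hx.isSemisimpleTensorCategoryOverRing hd e)
    ⟨𝟭 _, inferInstance, inferInstance, inferInstance, inferInstance⟩ h'⟩

namespace FusionBasis

/-- The algebraic numbers that are integral with respect to an embedding. -/
noncomputable abbrev integers : Subring QBar := (𝒪[PadicAlgCl p]).comap ι

noncomputable instance : Algebra (integers ι) (ZpBar p) :=
  ((ι.comp (integers ι).subtype).codRestrict 𝒪[PadicAlgCl p] fun a => a.2).toAlgebra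

/-- The lift is the integral form over `integers ι`, extended to `ZpBar p`. The unit of `C` is
simple and hence isomorphic to a member, which is where the unit of the lift gets its endomorphism
ring. -/
theorem isGoodPrime [IsFusionCategory QBar C] (B : FusionBasis QBar C)
    [B.IsDefinedOver (integers ι)] : IsGoodPrime p ι C := by
  obtain ⟨i, ⟨e⟩⟩ : ∃ i, Nonempty (𝟙_ C ≅ B.obj i) := by
    have := IsSemisimpleTensorCategory.simple_unit (k := QBar) (C := C)
    exact B.schur.exists_iso_of_simple (fun X => ⟨B.decomposition X⟩) _
  obtain ⟨e⟩ := IntegralForm.nonempty_tensorUnit_iso B (integers ι) e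
  exact .of_lift ι (ScalarExtension.schurFamily IntegralForm.schurFamily)
    (ScalarExtension.nonempty_decomposition fun X => ⟨IntegralForm.decomposition X⟩)
    ((ScalarExtension.incl (integers ι) (ZpBar p) _).mapIso e)
    (IntegralForm.sameGrothendieckRing B _ _ _)
    (letI := ι.toAlgebra; IntegralForm.tensorEquivalent B (integers ι) _ _ fun _ => rfl)

end FusionBasis

end

/-! ### Finiteness of the set of bad primes -/

theorem mainTheorem7
    (ι : ∀ (p : ℕ) [Fact p.Prime], QBar →+* PadicAlgCl p)
    (C : Type u) [Category.{v} C] [Abelian C] [Linear QBar C] [MonoidalCategory C]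
    [MonoidalPreadditive C] [MonoidalLinear QBar C] [RigidCategory C]
    [IsFusionCategory QBar C] :
    {p : ℕ | ∃ _ : Fact p.Prime, IsBadPrime p (ι p) C}.Finite := by
  obtain ⟨B⟩ := FusionBasis.nonempty QBar C
  obtain ⟨T, hT, h⟩ := B.exists_finite_isDefinedOver
  -- A prime outside the exceptional sets of all structure constants in `T` has `T` inside `integers
  -- (ι p)`, so the category is defined over that subring.
  refine (hT.biUnion fun a _ => finite_setOf_not_integral ι a).subset ?_
  rintro p ⟨hp, hbad⟩
  by_contra hmem
  have := h (FusionBasis.integers (ι p)) fun a ha =>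
    by_contra fun h' => hmem (Set.mem_biUnion ha ⟨hp, h'⟩)
  exact hbad (B.isGoodPrime (ι p))
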